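/- Let $a:[0,1]\to\mathbb R$ satisfy $a(0)=0$ and $a>0$ on $(0,1]$, and put $K:=\sup_{x\in(0,1]}\frac{x|a'(x)|}{a(x)}$. Assume that $a$ is either weakly degenerate (WD), i.e. $a\in C[0,1]\cap C^1(0,1]$ and $K\in(0,1)$, or strongly degenerate (SD), i.e. $a\in C^1[0,1]$ and $K\in[1,2)$. Let $L^2_{1/a}=\{u\in L^2(0,1):\int_0^1u^2/a\,dx<\infty\}$, $H^2_{1/a}=L^2_{1/a}\cap H^2_0(0,1)$, $Au=au''''$ on $D(A)=\{u\in H^2_{1/a}: au''''\in L^2_{1/a}\}$, and $\mathcal H_0=H^2_{1/a}\times L^2_{1/a}$ with $\|(u,v)\|^2=\int_0^1(u'')^2dx+\int_0^1 v^2/a\,dx$. Consider the clamped problem $$y_{tt}+a\,y_{xxxx}=0 \text{ in }(0,\infty)\times(0,1),\qquad y=y_x=0\ \text{ at } x=0 \text{ and } x=1,$$ with initial data $(y(0),y_t(0))\in\mathcal H_0$. Its mild solutions are the functions $y\in C^1([0,\infty);L^2_{1/a})\cap C([0,\infty);H^2_{1/a})$ with $\int_0^t y\,ds\in D(A)$ and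 $y_t(t)=y_t(0)-A\int_0^t y\,ds$ for all $t\ge0$. Their energy is $E_y(t)=\frac12\int_0^1\big(y_t^2/a+y_{xx}^2\big)dx$. A mild solution is classical if $y\in C^2([0,\infty);L^2_{1/a})\cap C^1([0,\infty);H^2_{1/a})\cap C([0,\infty);D(A))$ and $y_{tt}=-Ay$ for all $t\ge 0$; then $y_{xx}(t,1)$ is the value at $x=1$ of $y_{xx}(t,\cdot)$. For a mild solution, $y_{xx}(\cdot,1)\in L^2(0,T)$ is the limit in $L^2(0,T)$ of $y^n_{xx}(\cdot,1)$ for classical solutions $y^n$ whose initial data converge to those of $y$ in $\mathcal H_0$. If $$T>\frac{4}{2-K}\max\Big\{1,\frac4{a(1)},\frac{4K}{a(1)}\Big\},$$ then the problem is observable in time $T$: there is $C>0$ such that every mild solution $y$ has a trace $y_{xx}(\cdot,1)\in L^2(0,T)$ in this sense and satisfies $$C\,E_y(0)\le\int_0^T y_{xx}(t,1)^2\,dt .$$ Moreover, the supremum $C_T\in(0,\infty]$ of all such constants $C$ satisfies $$C_T\ \ge\ T(2-K)-4\max\Big\{1,\frac4{a(1)},\frac{4K}{a(1)}\Big\}.$$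 -/

import Mathlib

open MeasureTheory Filter Topology Set
open scoped ContDiff

namespace Beam

/-- The degeneracy constant `K = sup_{x ∈ (0,1]} x |a'(x)| / a(x)`. (If the set is unbounded, the
real supremum is `0` by convention; both degeneracy classes below exclude the value `0`.) -/
noncomputable def degConst (a : ℝ → ℝ) : ℝ :=
  sSup ((fun x : ℝ => x * |derivWithin a (Ioc 0 1) x| / a x) '' Ioc 0 1)

/-- `a` is weakly degenerate at `0`. Only the values of `a` on `[0,1]` matter. -/
structure WeaklyDegenerate (a : ℝ → ℝ) : Prop where
  continuousOn : ContinuousOn a (Icc 0 1)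
  contDiffOn : ContDiffOn ℝ 1 a (Ioc 0 1)
  zero : a 0 = 0
  pos : ∀ x ∈ Ioc (0 : ℝ) 1, 0 < a x
  const_mem : degConst a ∈ Ioo (0 : ℝ) 1

/-- `a` is strongly degenerate at `0`. -/
structure StronglyDegenerate (a : ℝ → ℝ) : Prop where
  contDiffOn : ContDiffOn ℝ 1 a (Icc 0 1)
  zero : a 0 = 0
  pos : ∀ x ∈ Ioc (0 : ℝ) 1, 0 < a x
  const_mem : degConst a ∈ Ico (1 : ℝ) 2

/-- Lebesgue measure on `(0,1)`. -/
noncomputable def vol01 : Measure ℝ := volume.restrict (Ioo 0 1)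

/-- The measure `dx / a(x)` on `(0,1)`. -/
noncomputable def wvol (a : ℝ → ℝ) : Measure ℝ :=
  vol01.withDensity fun x => ENNReal.ofReal (1 / a x)

/-- `L²(0,1)`. -/
abbrev L2 : Type := Lp ℝ 2 vol01

/-- `L²_{1/a}(0,1)`, with `‖u‖² = ∫₀¹ u² / a dx`. As `a` is bounded, each element lies in
`L²(0,1)`. -/
abbrev L2w (a : ℝ → ℝ) : Type := Lp ℝ 2 (wvol a)

/-- `w` is the `k`-th weak derivative of `u` on `(0,1)`. -/
def HasWeakDeriv (k : ℕ) (u w : ℝ → ℝ) : Prop :=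
  LocallyIntegrableOn u (Ioo 0 1) ∧ LocallyIntegrableOn w (Ioo 0 1) ∧
    ∀ φ : ℝ → ℝ, ContDiff ℝ ∞ φ → HasCompactSupport φ → tsupport φ ⊆ Ioo 0 1 →
      ∫ x in Ioo (0 : ℝ) 1, u x * iteratedDeriv k φ x =
        (-1) ^ k * ∫ x in Ioo (0 : ℝ) 1, w x * φ x

/-- `c` is the value at the boundary point `x₀` of the function class `u` on `(0,1)`: `u x → c` as
`x → x₀` inside `(0,1)`, up to a null set. If `u` has a representative that is continuous up to
`x₀`, this is the value of that representative at `x₀`. -/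
def HasBdryValue (u : ℝ → ℝ) (x₀ c : ℝ) : Prop :=
  Tendsto u (𝓝 x₀ ⊓ ae vol01) (𝓝 c)

/-- `u ∈ H²_{1/a}(0,1) = L²_{1/a}(0,1) ∩ H²₀(0,1)` and `u'' = q`. -/
def InH2 (a : ℝ → ℝ) (u : L2w a) (q : L2) : Prop :=
  MemLp u 2 vol01 ∧ ∃ p : L2, HasWeakDeriv 1 u p ∧ HasWeakDeriv 2 u q ∧
    HasBdryValue u 0 0 ∧ HasBdryValue u 1 0 ∧ HasBdryValue p 0 0 ∧ HasBdryValue p 1 0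

/-- `u ∈ D(A)` and `A u = a u'''' = f`: here `u ∈ H²_{1/a}(0,1)` and `a u'''' ∈ L²_{1/a}(0,1)`. -/
def InDA (a : ℝ → ℝ) (u f : L2w a) : Prop :=
  (∃ q : L2, InH2 a u q) ∧
    ∃ g : ℝ → ℝ, HasWeakDeriv 4 u g ∧ (fun x => a x * g x) =ᵐ[vol01] f

/-- A mild solution on `[0,∞)` of `y_tt + a y_xxxx = 0` on `(0,1)` with `y = y_x = 0` at `x = 0, 1`.
It has `y ∈ C¹([0,∞); L²_{1/a}) ∩ C([0,∞); H²_{1/a})` and `U = (y, y_t)` satisfies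
`U(t) = U(0) + 𝒜 ∫₀ᵗ U(s) ds`, where `𝒜 (u, v) = (v, -A u)` on `D(A) × H²_{1/a}`, that is
`∫₀ᵗ y ds ∈ D(A)` and `y_t(t) = y_t(0) - A ∫₀ᵗ y ds` (the first component says that `y_t` is the
time derivative of `y`, and gives `∫₀ᵗ y_t ds = y(t) - y(0) ∈ H²_{1/a}`).
Values at negative times are irrelevant. -/
structure MildSolution (a : ℝ → ℝ) where
  /-- `y(t, ·)` -/
  y : ℝ → L2w a
  /-- `y_t(t, ·)` -/
  yt : ℝ → L2w a
  /-- `y_xx(t, ·)` -/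
  yxx : ℝ → L2
  inH2 : ∀ t, 0 ≤ t → InH2 a (y t) (yxx t)
  continuousOn_yxx : ContinuousOn yxx (Ici 0)
  hasDeriv_y : ∀ t, 0 ≤ t → HasDerivWithinAt y (yt t) (Ici 0) t
  continuousOn_yt : ContinuousOn yt (Ici 0)
  mild : ∀ t, 0 ≤ t → InDA a (∫ s in (0 : ℝ)..t, y s) (yt 0 - yt t)

/-- The energy `E_y(t) = 1/2 ∫₀¹ (y_t² / a + y_xx²) dx`. -/
noncomputable def MildSolution.energy {a : ℝ → ℝ} (Y : MildSolution a) (t : ℝ) : ℝ :=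
  (1 / 2) * ∫ x in Ioo (0 : ℝ) 1, ((Y.yt t x) ^ 2 / a x + (Y.yxx t x) ^ 2)

/-- The solution is classical:
`y ∈ C²([0,∞); L²_{1/a}) ∩ C¹([0,∞); H²_{1/a}) ∩ C([0,∞); D(A))`, and `y_tt = -A y` on `[0,∞)`. -/
def MildSolution.IsClassical {a : ℝ → ℝ} (Y : MildSolution a) : Prop :=
  (∃ f : ℝ → L2w a, ContinuousOn f (Ici 0) ∧
    ∀ t, 0 ≤ t → InDA a (Y.y t) (f t) ∧ HasDerivWithinAt Y.yt (-f t) (Ici 0) t) ∧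
  ∃ r : ℝ → L2, ContinuousOn r (Ici 0) ∧
    ∀ t, 0 ≤ t → InH2 a (Y.yt t) (r t) ∧ HasDerivWithinAt Y.yxx (r t) (Ici 0) t

/-- Lebesgue measure on `(0,T)`. -/
noncomputable def volT (T : ℝ) : Measure ℝ := volume.restrict (Ioo 0 T)

/-- `g = y_xx(·, 1)` in `L²(0,T)`. For a classical solution, `y_xx(t, 1)` is the boundary value at
`x = 1` of `y_xx(t, ·)`. For a mild solution, `y_xx(·, 1)` is the `L²(0,T)`-limit of these functions
along classical solutions whose initial data converge in `H²_{1/a} × L²_{1/a}`, normed by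
`‖(u, v)‖² = ∫₀¹ (u'')² dx + ∫₀¹ v² / a dx`. -/
def MildSolution.HasBoundaryTrace {a : ℝ → ℝ} (Y : MildSolution a) (T : ℝ) (g : ℝ → ℝ) : Prop :=
  MemLp g 2 (volT T) ∧
  ∃ (Z : ℕ → MildSolution a) (β : ℕ → ℝ → ℝ),
    (∀ n, (Z n).IsClassical) ∧
    (∀ n, ∀ t ∈ Icc 0 T, HasBdryValue ((Z n).yxx t) 1 (β n t)) ∧
    (∀ n, MemLp (β n) 2 (volT T)) ∧
    Tendsto (fun n => ‖(Z n).yxx 0 - Y.yxx 0‖ ^ 2 + ‖(Z n).yt 0 - Y.yt 0‖ ^ 2) atTop (𝓝 0) ∧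
    Tendsto (fun n => eLpNorm (β n - g) 2 (volT T)) atTop (𝓝 0)

/-- `C > 0` is an observability constant in time `T`: for every solution, `y_xx(·, 1)` is defined
in `L²(0,T)` and `C E_y(0) ≤ ∫₀ᵀ y_xx(t, 1)² dt`. -/
def IsObservabilityConstant (a : ℝ → ℝ) (T C : ℝ) : Prop :=
  0 < C ∧ ∀ Y : MildSolution a,
    (∃ g, Y.HasBoundaryTrace T g) ∧
    ∀ g, Y.HasBoundaryTrace T g → C * Y.energy 0 ≤ ∫ t in Ioo 0 T, (g t) ^ 2

/-- The problem is observable in time `T` via the second derivative at `x = 1`. -/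
def Observable (a : ℝ → ℝ) (T : ℝ) : Prop :=
  ∃ C : ℝ, IsObservabilityConstant a T C

/-- `C_T`, the supremum of all observability constants in time `T` (in the extended reals). -/
noncomputable def bestConst (a : ℝ → ℝ) (T : ℝ) : EReal :=
  sSup ((fun C : ℝ => (C : EReal)) '' {C | IsObservabilityConstant a T C})

end Beam

namespace Beam

/-! The proof is by multipliers. Write q = y_xx, v = y_t, r = v_xx, f = Ay, and let P send the
second derivative of a function u to x u'. Pairing the equation with x y_x in L²_{1/a} produces the
observed quantity at the nondegenerate end: ⟨Pq, f⟩ = (3/2)‖q‖² - (1/2) y_xx(t,1)²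
(`IsWeight.inner_opP_eq`). Since x|a'| ≤ K a, the number -2⟨Pr, v⟩ lies between (1-K)‖v‖² and
(1+K)‖v‖² (`IsWeight.inner_opP_opJ`). Together, y_xx(t,1)² = 2 d/dt ⟨x y_x, y_t⟩ + 3‖q‖² - 2⟨Pr, v⟩.
For the lower bound, K/2 times the identity d/dt ⟨y, y_t⟩ = ‖v‖² - ‖q‖² rebalances the two energies;
as E is conserved, each unit of time contributes at least (2-K)E. The terms at times 0 and T are
controlled by ‖y‖, ‖x y_x‖ ≤ ‖y_xx‖/√a(1), a consequence of x²/a ≤ 1/a(1), which is where K < 2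
enters (`IsWeight.sq_div_le`). The upper bound gives the direct inequality
`IsClassicalData.integral_trace_sq_le`.

The degenerate end contributes nothing: for u in D(A), integrating f/a from x = 1 gives u''' =
O(x^{-1/2}) and u'' bounded (`IsWeight.exists_isRegular`), so all boundary terms at 0 vanish. The
spaces are described through q alone: u lies in H²_{1/a} when u = Jq, J being double integration
from 0, and q satisfies two linear constraints (`IsWeight.inH2_iff`); f = Au is a duality relation
against H²_{1/a} (`IsWeight.inDA_iff`). Both descriptions pass to linear combinations and time
integrals.

Averaging a mild solution over [t, t+h] yields a classical one whose data converge as h → 0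
(`MildSolution.isClassicalData_avg`). The direct inequality makes the traces Cauchy, hence a trace
exists, and the lower bound passes to the limit. -/

/-! ### Absolutely continuous functions with a prescribed derivative -/

/-- `F` is absolutely continuous on `[c, d]` with derivative `f` almost everywhere. -/
structure IsPrim (c d : ℝ) (F f : ℝ → ℝ) : Prop where
  ac : AbsolutelyContinuousOnInterval F c d
  hasDerivAt : ∀ᵐ x, x ∈ uIcc c d → HasDerivAt F (f x) x

namespace IsPrim

variable {c d : ℝ} {F f G g : ℝ → ℝ}

lemma deriv_ae (h : IsPrim c d F f) : deriv F =ᵐ[volume.restrict (uIoc c d)] f := by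
  rw [EventuallyEq, ae_restrict_iff' measurableSet_uIoc]
  filter_upwards [h.hasDerivAt] with x hx hx'
  exact (hx (uIoc_subset_uIcc hx')).deriv

lemma intervalIntegrable (h : IsPrim c d F f) : IntervalIntegrable f volume c d :=
  h.ac.intervalIntegrable_deriv.congr_ae h.deriv_ae

lemma integral_eq (h : IsPrim c d F f) : ∫ x in c..d, f x = F d - F c := by
  rw [← h.ac.integral_deriv_eq_sub]
  exact (intervalIntegral.integral_congr_ae_restrict h.deriv_ae).symm

lemma continuousOn (h : IsPrim c d F f) : ContinuousOn F (uIcc c d) := h.ac.continuousOn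

lemma mono (h : IsPrim c d F f) {c' d' : ℝ} (hs : uIcc c' d' ⊆ uIcc c d) : IsPrim c' d' F f :=
  ⟨h.ac.mono hs, h.hasDerivAt.mono fun _ hx hx' => hx (hs hx')⟩

lemma congr_ae (h : IsPrim c d F f) (hfg : ∀ᵐ x, x ∈ uIcc c d → f x = g x) : IsPrim c d F g := by
  refine ⟨h.ac, ?_⟩
  filter_upwards [h.hasDerivAt, hfg] with x hx hx' hm
  rw [← hx' hm]; exact hx hm

lemma add (h : IsPrim c d F f) (h' : IsPrim c d G g) :
    IsPrim c d (fun x => F x + G x) (fun x => f x + g x) := by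
  refine ⟨h.ac.fun_add h'.ac, ?_⟩
  filter_upwards [h.hasDerivAt, h'.hasDerivAt] with x hx hx' hm
  exact (hx hm).fun_add (hx' hm)

lemma sub (h : IsPrim c d F f) (h' : IsPrim c d G g) :
    IsPrim c d (fun x => F x - G x) (fun x => f x - g x) := by
  refine ⟨h.ac.fun_sub h'.ac, ?_⟩
  filter_upwards [h.hasDerivAt, h'.hasDerivAt] with x hx hx' hm
  exact (hx hm).fun_sub (hx' hm)

lemma mul (h : IsPrim c d F f) (h' : IsPrim c d G g) :
    IsPrim c d (fun x => F x * G x) (fun x => f x * G x + F x * g x) := by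
  refine ⟨h.ac.fun_mul h'.ac, ?_⟩
  filter_upwards [h.hasDerivAt, h'.hasDerivAt] with x hx hx' hm
  exact (hx hm).fun_mul (hx' hm)

lemma primitive {c d e : ℝ} (h : IntervalIntegrable f volume c d) (he : e ∈ uIcc c d) :
    IsPrim c d (fun x => ∫ s in e..x, f s) f := by
  refine ⟨h.absolutelyContinuousOnInterval_intervalIntegral he, ?_⟩
  filter_upwards [h.ae_hasDerivAt_integral] with x hx hm
  exact hx hm e he

lemma of_contDiffOn (hF : ContDiffOn ℝ 1 F (uIcc c d))
    (hf : ∀ x ∈ Ioo (min c d) (max c d), HasDerivAt F (f x) x) : IsPrim c d F f := by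
  refine ⟨hF.absolutelyContinuousOnInterval, ?_⟩
  -- The derivative is given only inside the interval; the two endpoints form a null set.
  have h1 : ∀ᵐ x : ℝ, x ≠ min c d := by simp [ae_iff, measure_singleton]
  have h2 : ∀ᵐ x : ℝ, x ≠ max c d := by simp [ae_iff, measure_singleton]
  filter_upwards [h1, h2] with x hx1 hx2 hm
  exact hf x ⟨lt_of_le_of_ne hm.1 (Ne.symm hx1), lt_of_le_of_ne hm.2 hx2⟩

lemma of_contDiff (hF : ContDiff ℝ 1 F) : IsPrim c d F (deriv F) :=
  of_contDiffOn hF.contDiffOn fun x _ =>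
    (hF.differentiable one_ne_zero x).hasDerivAt

lemma const (k : ℝ) : IsPrim c d (fun _ => k) (fun _ => 0) :=
  of_contDiffOn contDiffOn_const fun x _ => hasDerivAt_const x k

lemma id : IsPrim c d (fun x => x) (fun _ => 1) :=
  of_contDiffOn contDiffOn_id fun x _ => hasDerivAt_id x

end IsPrim

/-! ### Test functions and weak derivatives on `(0,1)` -/

/-- Test functions on `(0,1)`. -/
structure IsTest (φ : ℝ → ℝ) : Prop where
  contDiff : ContDiff ℝ ∞ φ
  hasCompactSupport : HasCompactSupport φ
  tsupport_subset : tsupport φ ⊆ Ioo 0 1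

lemma exists_margin {s : Set ℝ} (hs : IsCompact s) (h : s ⊆ Ioo 0 1) :
    ∃ δ, 0 < δ ∧ δ < 1 / 2 ∧ s ⊆ Icc δ (1 - δ) := by
  rcases s.eq_empty_or_nonempty with rfl | hne
  · exact ⟨1 / 4, by norm_num, by norm_num, empty_subset _⟩
  obtain ⟨b, hb⟩ := hs.bddBelow
  have h1 := h (hs.sInf_mem hne)
  have h2 := h (hs.sSup_mem hne)
  refine ⟨min (1 / 4) (min (sInf s) (1 - sSup s)), ?_, ?_, fun x hx => ⟨?_, ?_⟩⟩
  · have := h1.1; have := h2.2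
    simp only [lt_min_iff]; refine ⟨by norm_num, by linarith, by linarith⟩
  · exact lt_of_le_of_lt (min_le_left _ _) (by norm_num)
  · exact (min_le_right _ _).trans ((min_le_left _ _).trans (csInf_le hs.bddBelow hx))
  · have := (min_le_right (1 / 4) (min (sInf s) (1 - sSup s))).trans (min_le_right _ _)
    have := le_csSup hs.bddAbove hx
    linarith

namespace IsTest

variable {φ ψ : ℝ → ℝ}

lemma exists_support (h : IsTest φ) :
    ∃ δ, 0 < δ ∧ δ < 1 / 2 ∧ tsupport φ ⊆ Icc δ (1 - δ) :=
  exists_margin h.hasCompactSupport h.tsupport_subset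

lemma deriv (h : IsTest φ) : IsTest (_root_.deriv φ) :=
  ⟨(contDiff_infty_iff_deriv.1 h.contDiff).2, h.hasCompactSupport.deriv,
    subset_trans tsupport_deriv_subset h.tsupport_subset⟩

lemma iteratedDeriv (h : IsTest φ) (k : ℕ) : IsTest (iteratedDeriv k φ) := by
  induction k generalizing φ with
  | zero => simpa using h
  | succ k ih => rw [iteratedDeriv_succ']; exact ih h.deriv

lemma continuous (h : IsTest φ) : Continuous φ := h.contDiff.continuous

lemma differentiable (h : IsTest φ) : Differentiable ℝ φ := h.contDiff.differentiable (by simp)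

lemma sub_const_mul (h : IsTest φ) (h' : IsTest ψ) (c : ℝ) : IsTest (fun x => φ x - c * ψ x) := by
  have hs : tsupport (fun x => φ x - c * ψ x) ⊆ tsupport φ ∪ tsupport ψ := by
    refine closure_minimal (fun x hx => ?_) ((isClosed_tsupport φ).union (isClosed_tsupport ψ))
    by_contra hn
    simp only [mem_union, not_or] at hn
    exact hx (by simp [image_eq_zero_of_notMem_tsupport hn.1,
      image_eq_zero_of_notMem_tsupport hn.2])
  refine ⟨h.contDiff.sub (contDiff_const.mul h'.contDiff), ?_, hs.trans
    (union_subset h.tsupport_subset h'.tsupport_subset)⟩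
  exact (h.hasCompactSupport.isCompact.union h'.hasCompactSupport.isCompact).of_isClosed_subset
    (isClosed_tsupport _) hs

lemma setIntegral_eq (_h : IsTest φ) (u : ℝ → ℝ) {δ : ℝ} (hδ : 0 < δ) (hδ' : δ < 1 / 2)
    (hs : tsupport φ ⊆ Icc δ (1 - δ)) :
    ∫ x in Ioo (0 : ℝ) 1, u x * φ x = ∫ x in δ..(1 - δ), u x * φ x := by
  rw [intervalIntegral.integral_of_le (by linarith), ← integral_Icc_eq_integral_Ioc]
  refine setIntegral_eq_of_subset_of_forall_sdiff_eq_zero measurableSet_Ioo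
    (fun x hx => ⟨by linarith [hx.1], by linarith [hx.2]⟩) fun x hx => ?_
  rw [image_eq_zero_of_notMem_tsupport fun hn => hx.2 (hs hn), mul_zero]

lemma integrable_mul (h : IsTest φ) {u : ℝ → ℝ} (hu : LocallyIntegrableOn u (Ioo 0 1)) :
    IntegrableOn (fun x => u x * φ x) (Ioo 0 1) := by
  have h1 : IntegrableOn u (tsupport φ) :=
    hu.integrableOn_compact_subset h.tsupport_subset h.hasCompactSupport
  have h2 : IntegrableOn (fun x => u x * φ x) (tsupport φ) :=
    h1.mul_continuousOn h.continuous.continuousOn h.hasCompactSupport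
  have h3 : Integrable (fun x => u x * φ x) := by
    refine (integrableOn_iff_integrable_of_support_subset fun x hx => ?_).1 h2
    exact subset_tsupport _ (right_ne_zero_of_mul hx)
  exact h3.integrableOn

/-- A test function with mean zero is the derivative of a test function. -/
lemma exists_deriv_eq (h : IsTest ψ) (h0 : ∫ x in Ioo (0 : ℝ) 1, ψ x = 0) :
    ∃ φ, IsTest φ ∧ _root_.deriv φ = ψ := by
  obtain ⟨δ, hδ, hδ', hs⟩ := h.exists_support
  have hz : ∀ x, x ∉ Icc δ (1 - δ) → ψ x = 0 := fun x hx =>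
    image_eq_zero_of_notMem_tsupport fun hn => hx (hs hn)
  have hd : ∀ x, HasDerivAt (fun x => ∫ s in (0 : ℝ)..x, ψ s) (ψ x) x := fun x =>
    intervalIntegral.integral_hasDerivAt_right (h.continuous.intervalIntegrable _ _)
      h.continuous.stronglyMeasurable.stronglyMeasurableAtFilter h.continuous.continuousAt
  have hder : _root_.deriv (fun x => ∫ s in (0 : ℝ)..x, ψ s) = ψ := funext fun x => (hd x).deriv
  -- Left of δ nothing has been integrated yet; right of 1 - δ the primitive equals the full
  -- integral of ψ, which is zero.
  have hsupp : Function.support (fun x => ∫ s in (0 : ℝ)..x, ψ s) ⊆ Icc δ (1 - δ) := by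
    intro x hx
    by_contra hn
    apply hx
    rcases lt_or_ge x δ with hlt | hge
    · refine intervalIntegral.integral_zero_ae (Eventually.of_forall fun s hs' => hz s fun hm => ?_)
      rcases le_total 0 x with h0x | hx0
      · rw [uIoc_of_le h0x] at hs'; linarith [hs'.2, hm.1]
      · rw [uIoc_of_ge hx0] at hs'; linarith [hs'.2, hm.1]
    · have hx1 : 1 - δ < x := by
        by_contra hc; exact hn ⟨hge, not_lt.1 hc⟩
      have e1 : ∫ s in (0 : ℝ)..1, ψ s = 0 := by
        rw [intervalIntegral.integral_of_le zero_le_one, integral_Ioc_eq_integral_Ioo, h0]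
      have e2 : ∫ s in (1 : ℝ)..x, ψ s = 0 := by
        refine intervalIntegral.integral_zero_ae
          (Eventually.of_forall fun s hs' => hz s fun hm => ?_)
        rcases le_total 1 x with h0x | hx0
        · rw [uIoc_of_le h0x] at hs'; linarith [hs'.1, hm.2]
        · rw [uIoc_of_ge hx0] at hs'; linarith [hs'.1, hm.2]
      show ∫ s in (0 : ℝ)..x, ψ s = 0
      rw [← intervalIntegral.integral_add_adjacent_intervals
        (h.continuous.intervalIntegrable 0 1) (h.continuous.intervalIntegrable 1 x), e1, e2,
        add_zero]
  have hts : tsupport (fun x => ∫ s in (0 : ℝ)..x, ψ s) ⊆ Icc δ (1 - δ) :=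
    closure_minimal hsupp isClosed_Icc
  refine ⟨_, ⟨?_, ?_, ?_⟩, hder⟩
  · rw [contDiff_infty_iff_deriv, hder]
    exact ⟨fun x => (hd x).differentiableAt, h.contDiff⟩
  · exact isCompact_Icc.of_isClosed_subset (isClosed_tsupport _) hts
  · exact hts.trans fun x hx => ⟨by linarith [hx.1], by linarith [hx.2]⟩

lemma exists_integral_eq_one : ∃ η, IsTest η ∧ ∫ x in Ioo (0 : ℝ) 1, η x = 1 := by
  let b : ContDiffBump (1 / 2 : ℝ) := ⟨1 / 8, 1 / 4, by norm_num, by norm_num⟩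
  have hs : tsupport (b.normed volume) ⊆ Ioo 0 1 := by
    rw [b.tsupport_normed_eq]
    intro x hx
    rw [Metric.mem_closedBall, Real.dist_eq, abs_le] at hx
    have : b.rOut = 1 / 4 := rfl
    rw [this] at hx
    constructor <;> linarith [hx.1, hx.2]
  refine ⟨b.normed volume, ⟨b.contDiff_normed, b.hasCompactSupport_normed, hs⟩, ?_⟩
  rw [setIntegral_eq_integral_of_forall_compl_eq_zero fun x hx =>
    image_eq_zero_of_notMem_tsupport fun hn => hx (hs hn)]
  exact b.integral_normed

end IsTest

variable {u v w W : ℝ → ℝ}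

lemma intervalIntegrable_of_locallyIntegrableOn (hw : LocallyIntegrableOn w (Ioo 0 1)) {c d : ℝ}
    (hc : c ∈ Ioo (0 : ℝ) 1) (hd : d ∈ Ioo (0 : ℝ) 1) : IntervalIntegrable w volume c d := by
  rw [intervalIntegrable_iff']
  exact hw.integrableOn_compact_subset (ordConnected_Ioo.uIcc_subset hc hd) isCompact_uIcc

/-- Integration by parts against a test function. -/
lemma IsTest.integral_mul_deriv {φ : ℝ → ℝ} (hφ : IsTest φ)
    (hW : ∀ δ, 0 < δ → δ < 1 / 2 → IsPrim δ (1 - δ) W w) :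
    ∫ x in Ioo (0 : ℝ) 1, W x * _root_.deriv φ x = -∫ x in Ioo (0 : ℝ) 1, w x * φ x := by
  obtain ⟨δ, hδ, hδ', hs⟩ := hφ.exists_support
  -- With the margin halved, the endpoints of the interval of integration lie outside the support
  -- and the boundary terms vanish.
  have hs2 : tsupport φ ⊆ Icc (δ / 2) (1 - δ / 2) :=
    hs.trans (Icc_subset_Icc (by linarith) (by linarith))
  rw [hφ.setIntegral_eq w (half_pos hδ) (by linarith) hs2,
    hφ.deriv.setIntegral_eq W (half_pos hδ) (by linarith)
      (subset_trans tsupport_deriv_subset hs2)]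
  have hp := hW (δ / 2) (by linarith) (by linarith)
  have hq : IsPrim (δ / 2) (1 - δ / 2) φ (_root_.deriv φ) :=
    IsPrim.of_contDiff (hφ.contDiff.of_le (by exact_mod_cast le_top))
  have h0 := (hp.mul hq).integral_eq
  rw [intervalIntegral.integral_add
    (hp.intervalIntegrable.mul_continuousOn hφ.continuous.continuousOn)
    (hq.intervalIntegrable.continuousOn_mul hp.continuousOn)] at h0
  have z1 : φ (δ / 2) = 0 := image_eq_zero_of_notMem_tsupport fun hn => by
    have := (hs hn).1; linarith
  have z2 : φ (1 - δ / 2) = 0 := image_eq_zero_of_notMem_tsupport fun hn => by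
    have := (hs hn).2; linarith
  rw [z1, z2] at h0
  linarith

lemma isPrim_integral_half (hw : LocallyIntegrableOn w (Ioo 0 1)) (k : ℝ) {δ : ℝ} (hδ : 0 < δ)
    (hδ' : δ < 1 / 2) :
    IsPrim δ (1 - δ) (fun x => (∫ s in (1 / 2 : ℝ)..x, w s) + k) w := by
  have h1 := IsPrim.primitive (e := 1 / 2) (intervalIntegrable_of_locallyIntegrableOn hw
    (c := δ) (d := 1 - δ) ⟨hδ, by linarith⟩ ⟨by linarith, by linarith⟩)
    (by rw [uIcc_of_le (by linarith)]; exact ⟨by linarith, by linarith⟩)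
  exact (h1.add (IsPrim.const k)).congr_ae (Eventually.of_forall fun x _ => add_zero _)

lemma locallyIntegrableOn_of_isPrim (hW : ∀ δ, 0 < δ → δ < 1 / 2 → IsPrim δ (1 - δ) W w) :
    LocallyIntegrableOn W (Ioo 0 1) := by
  refine ContinuousOn.locallyIntegrableOn (fun x hx => ContinuousAt.continuousWithinAt ?_)
    measurableSet_Ioo
  have h0 : 0 < min x (1 - x) / 2 := by
    have := lt_min hx.1 (sub_pos.2 hx.2); linarith
  have h1 : min x (1 - x) / 2 < 1 / 2 := by
    have := min_le_left x (1 - x); have := hx.2; linarith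
  refine (hW _ h0 h1).continuousOn.continuousAt ?_
  have := min_le_left x (1 - x); have := min_le_right x (1 - x)
  rw [uIcc_of_le (by linarith)]
  exact Icc_mem_nhds (by linarith) (by linarith)

/-- If the `k`-th weak derivative is absolutely continuous, then it can be differentiated. -/
lemma HasWeakDeriv.succ {k : ℕ} (h : HasWeakDeriv k u W)
    (hW : ∀ δ, 0 < δ → δ < 1 / 2 → IsPrim δ (1 - δ) W w) (hw : LocallyIntegrableOn w (Ioo 0 1)) :
    HasWeakDeriv (k + 1) u w := by
  refine ⟨h.1, hw, fun φ h1 h2 h3 => ?_⟩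
  have hφ : IsTest φ := ⟨h1, h2, h3⟩
  rw [iteratedDeriv_succ', h.2.2 _ hφ.deriv.1 hφ.deriv.2 hφ.deriv.3, hφ.integral_mul_deriv hW]
  ring

lemma HasWeakDeriv.congr {k : ℕ} (h : HasWeakDeriv k u w) (hu : u =ᵐ[vol01] v)
    (hw : w =ᵐ[vol01] W) : HasWeakDeriv k v W := by
  have aux : ∀ {f g : ℝ → ℝ}, f =ᵐ[vol01] g → LocallyIntegrableOn f (Ioo 0 1) →
      LocallyIntegrableOn g (Ioo 0 1) := by
    intro f g hfg hf
    rw [locallyIntegrableOn_iff isOpen_Ioo.isLocallyClosed] at hf ⊢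
    intro s hs hc
    exact (hf s hs hc).congr_fun_ae (ae_restrict_of_ae_restrict_of_subset hs hfg)
  refine ⟨aux hu h.1, aux hw h.2.1, fun φ h1 h2 h3 => ?_⟩
  have e1 : ∫ x in Ioo (0 : ℝ) 1, v x * iteratedDeriv k φ x =
      ∫ x in Ioo (0 : ℝ) 1, u x * iteratedDeriv k φ x :=
    integral_congr_ae (hu.mono fun x hx => by simp only [hx])
  have e2 : ∫ x in Ioo (0 : ℝ) 1, W x * φ x = ∫ x in Ioo (0 : ℝ) 1, w x * φ x :=
    integral_congr_ae (hw.mono fun x hx => by simp only [hx])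
  rw [e1, e2, h.2.2 φ h1 h2 h3]

/-- The fundamental lemma of the calculus of variations. Order zero is the base from which weak
derivatives are built up by `HasWeakDeriv.succ`, and where the descent by
`HasWeakDeriv.exists_lower` ends. -/
lemma hasWeakDeriv_zero_iff : HasWeakDeriv 0 u w ↔
    LocallyIntegrableOn u (Ioo 0 1) ∧ u =ᵐ[vol01] w := by
  constructor
  · intro h
    refine ⟨h.1, ?_⟩
    have := isOpen_Ioo.ae_eq_zero_of_integral_contDiff_smul_eq_zero (h.1.sub h.2.1)
      (fun φ h1 h2 h3 => ?_)
    · rw [EventuallyEq, vol01, ae_restrict_iff' measurableSet_Ioo]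
      filter_upwards [this] with x hx hm
      simpa [sub_eq_zero] using hx hm
    · have hφ : IsTest φ := ⟨h1, h2, h3⟩
      rw [← setIntegral_eq_integral_of_forall_compl_eq_zero (s := Ioo (0 : ℝ) 1) fun x hx => by
        rw [image_eq_zero_of_notMem_tsupport fun hn => hx (h3 hn), zero_smul]]
      have := h.2.2 φ h1 h2 h3
      simp only [iteratedDeriv_zero, pow_zero, one_mul] at this
      rw [← sub_eq_zero, ← integral_sub (hφ.integrable_mul h.1) (hφ.integrable_mul h.2.1)] at this
      refine Eq.trans (integral_congr_ae (Eventually.of_forall fun x => ?_)) this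
      simp only [smul_eq_mul, Pi.sub_apply]; ring
  · rintro ⟨h, he⟩
    have : HasWeakDeriv 0 u u := ⟨h, h, fun φ _ _ _ => by simp⟩
    exact this.congr EventuallyEq.rfl he

/-- Lemma of du Bois-Reymond: lowering the order of a weak derivative. -/
lemma HasWeakDeriv.exists_lower {k : ℕ} (h : HasWeakDeriv (k + 1) u w) :
    ∃ c : ℝ, HasWeakDeriv k u (fun x => (∫ s in (1 / 2 : ℝ)..x, w s) + c) := by
  obtain ⟨η, hη, hη1⟩ := IsTest.exists_integral_eq_one
  set W : ℝ → ℝ := fun x => ∫ s in (1 / 2 : ℝ)..x, w s with hWdef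
  have hprim : ∀ c δ, 0 < δ → δ < 1 / 2 → IsPrim δ (1 - δ) (fun x => W x + c) w :=
    fun c δ h1 h2 => isPrim_integral_half h.2.1 c h1 h2
  have hWl : LocallyIntegrableOn W (Ioo 0 1) := by
    simpa using locallyIntegrableOn_of_isPrim (hprim 0)
  -- This constant is forced by testing the desired identity with η, which has integral one.
  refine ⟨(-1) ^ k * (∫ x in Ioo (0 : ℝ) 1, u x * iteratedDeriv k η x) -
    ∫ x in Ioo (0 : ℝ) 1, W x * η x, h.1, locallyIntegrableOn_of_isPrim (hprim _),
    fun ψ h1 h2 h3 => ?_⟩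
  have hψ : IsTest ψ := ⟨h1, h2, h3⟩
  set c := ∫ x in Ioo (0 : ℝ) 1, ψ x with hc
  have hint : ∀ {θ : ℝ → ℝ}, IsTest θ → IntegrableOn θ (Ioo 0 1) := fun hθ =>
    (hθ.continuous.integrable_of_hasCompactSupport hθ.hasCompactSupport).integrableOn
  -- ψ minus its mean times η has mean zero, so it is φ' for a test function φ, and the hypothesis
  -- of order k + 1 applies to φ.
  obtain ⟨φ, hφ, hφd⟩ := (hψ.sub_const_mul hη c).exists_deriv_eq (by
    rw [integral_sub (hint hψ) ((hint hη).const_mul c), integral_const_mul, hη1, mul_one, hc,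
      sub_self])
  have key := h.2.2 φ hφ.1 hφ.2 hφ.3
  have ibp := hφ.integral_mul_deriv (hprim 0)
  simp only [add_zero] at ibp
  rw [iteratedDeriv_succ', hφd] at key
  rw [hφd] at ibp
  have e1 : iteratedDeriv k (fun x => ψ x - c * η x) =
      fun x => iteratedDeriv k ψ x - c * iteratedDeriv k η x := by
    funext x
    have hd : ContDiff ℝ k ψ := hψ.contDiff.of_le (by exact_mod_cast le_top)
    have hd' : ContDiff ℝ k η := hη.contDiff.of_le (by exact_mod_cast le_top)
    rw [iteratedDeriv_fun_sub hd.contDiffAt (contDiff_const.mul hd').contDiffAt,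
      iteratedDeriv_const_mul_field]
  rw [e1] at key
  have e2 : ∫ x in Ioo (0 : ℝ) 1, u x * (iteratedDeriv k ψ x - c * iteratedDeriv k η x) =
      (∫ x in Ioo (0 : ℝ) 1, u x * iteratedDeriv k ψ x) -
        c * ∫ x in Ioo (0 : ℝ) 1, u x * iteratedDeriv k η x := by
    rw [← integral_const_mul, ← integral_sub ((hψ.iteratedDeriv k).integrable_mul h.1)
      (((hη.iteratedDeriv k).integrable_mul h.1).const_mul c)]
    exact integral_congr_ae (Eventually.of_forall fun x => by ring)
  have e3 : ∫ x in Ioo (0 : ℝ) 1, W x * (ψ x - c * η x) =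
      (∫ x in Ioo (0 : ℝ) 1, W x * ψ x) - c * ∫ x in Ioo (0 : ℝ) 1, W x * η x := by
    rw [← integral_const_mul, ← integral_sub (hψ.integrable_mul hWl)
      ((hη.integrable_mul hWl).const_mul c)]
    exact integral_congr_ae (Eventually.of_forall fun x => by ring)
  have e4 : ∀ d : ℝ, ∫ x in Ioo (0 : ℝ) 1, (W x + d) * ψ x =
      (∫ x in Ioo (0 : ℝ) 1, W x * ψ x) + d * c := by
    intro d
    rw [hc, ← integral_const_mul, ← integral_add (hψ.integrable_mul hWl) ((hint hψ).const_mul d)]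
    exact integral_congr_ae (Eventually.of_forall fun x => by ring)
  rw [e2] at key
  rw [e3] at ibp
  rw [e4]
  have hsq : ((-1 : ℝ) ^ k) * (-1) ^ k = 1 := by rw [← mul_pow]; norm_num
  rw [pow_succ] at key
  linear_combination key - (-1) ^ k * ibp -
    c * (∫ x in Ioo (0 : ℝ) 1, u x * iteratedDeriv k η x) * hsq

/-! ### Boundary values -/

instance : IsFiniteMeasure vol01 := by unfold vol01; infer_instance

lemma ae_vol01_mem : ∀ᵐ x ∂vol01, x ∈ Ioo (0 : ℝ) 1 := ae_restrict_mem measurableSet_Ioo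

/-- Every neighbourhood of a point of [0,1] meets (0,1) in a set of positive measure. This makes
boundary values unique. -/
lemma nhds_inf_ae_vol01_neBot {x₀ : ℝ} (hx : x₀ ∈ Icc (0 : ℝ) 1) : (𝓝 x₀ ⊓ ae vol01).NeBot := by
  rw [inf_neBot_iff]
  intro U hU s hs
  by_contra hne
  have h1 : interior U ∩ Ioo 0 1 ⊆ sᶜ := fun y hy hys => hne ⟨y, interior_subset hy.1, hys⟩
  have h2 : (interior U ∩ Ioo (0 : ℝ) 1).Nonempty := by
    rw [← closure_Ioo zero_ne_one] at hx
    exact mem_closure_iff.1 hx _ isOpen_interior (mem_interior_iff_mem_nhds.2 hU)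
  have h3 : 0 < volume (interior U ∩ Ioo (0 : ℝ) 1) :=
    (isOpen_interior.inter isOpen_Ioo).measure_pos _ h2
  have h4 : vol01 sᶜ = 0 := hs
  have h5 : vol01 (interior U ∩ Ioo 0 1) = 0 := measure_mono_null h1 h4
  rw [vol01, Measure.restrict_apply (isOpen_interior.inter isOpen_Ioo).measurableSet,
    inter_assoc, inter_self] at h5
  exact h3.ne' h5

lemma HasBdryValue.congr {u v : ℝ → ℝ} {x₀ c : ℝ} (h : HasBdryValue u x₀ c)
    (huv : u =ᵐ[vol01] v) : HasBdryValue v x₀ c :=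
  Tendsto.congr' (huv.filter_mono inf_le_right) h

lemma HasBdryValue.unique {u : ℝ → ℝ} {x₀ c d : ℝ} (hx : x₀ ∈ Icc (0 : ℝ) 1)
    (h : HasBdryValue u x₀ c) (h' : HasBdryValue u x₀ d) : c = d := by
  have := nhds_inf_ae_vol01_neBot hx
  exact tendsto_nhds_unique h h'

lemma hasBdryValue_of_continuousWithinAt {u : ℝ → ℝ} {x₀ : ℝ}
    (h : ContinuousWithinAt u (Ioo 0 1) x₀) : HasBdryValue u x₀ (u x₀) :=
  h.mono_left (inf_le_inf_left _ (le_principal_iff.2 ae_vol01_mem))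

lemma hasBdryValue_of_continuousOn {u : ℝ → ℝ} (h : ContinuousOn u (Icc 0 1)) {x₀ : ℝ}
    (hx : x₀ ∈ Icc (0 : ℝ) 1) : HasBdryValue u x₀ (u x₀) :=
  hasBdryValue_of_continuousWithinAt ((h x₀ hx).mono Ioo_subset_Icc_self)

lemma HasWeakDeriv.unique {k : ℕ} {u v w : ℝ → ℝ} (h : HasWeakDeriv k u v)
    (h' : HasWeakDeriv k u w) : v =ᵐ[vol01] w := by
  refine (hasWeakDeriv_zero_iff.1 ⟨h.2.1, h'.2.1, fun φ h1 h2 h3 => ?_⟩).2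
  have e := (h.2.2 φ h1 h2 h3).symm.trans (h'.2.2 φ h1 h2 h3)
  simpa using mul_left_cancel₀ (pow_ne_zero k (by norm_num : (-1 : ℝ) ≠ 0)) e

/-! ### Primitives of square integrable functions -/

lemma integrableOn_L2 (q : L2) : IntegrableOn q (Ioo 0 1) :=
  (Lp.memLp q).integrable one_le_two

lemma intervalIntegrable_L2 (q : L2) {c d : ℝ} (hc : c ∈ Icc (0 : ℝ) 1) (hd : d ∈ Icc (0 : ℝ) 1) :
    IntervalIntegrable q volume c d := by
  have : IntervalIntegrable q volume 0 1 :=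
    (intervalIntegrable_iff_integrableOn_Ioo_of_le zero_le_one).2 (integrableOn_L2 q)
  refine this.mono_set ?_
  rw [uIcc_of_le zero_le_one]
  exact ordConnected_Icc.uIcc_subset hc hd

/-- The primitive of `q` that vanishes at `0`. -/
noncomputable def prim (q : ℝ → ℝ) (x : ℝ) : ℝ := ∫ s in (0 : ℝ)..x, q s

lemma isPrim_prim (q : L2) : IsPrim 0 1 (prim q) q :=
  IsPrim.primitive (intervalIntegrable_L2 q (by simp) (by simp)) (by simp)

lemma continuousOn_prim (q : L2) : ContinuousOn (prim q) (Icc 0 1) := by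
  simpa using (isPrim_prim q).continuousOn

/-- Cauchy-Schwarz against the indicator of (0,x), whose norm √x is at most 1. -/
lemma abs_prim_le (q : L2) {x : ℝ} (hx : x ∈ Icc (0 : ℝ) 1) : |prim q x| ≤ ‖q‖ := by
  have hm : vol01 (Ioo 0 x) ≠ ⊤ := measure_ne_top _ _
  have hr : vol01.restrict (Ioo 0 x) = volume.restrict (Ioo 0 x) := by
    rw [vol01, Measure.restrict_restrict measurableSet_Ioo,
      inter_eq_left.2 (Ioo_subset_Ioo_right hx.2)]
  have e : prim q x = inner ℝ (indicatorConstLp 2 measurableSet_Ioo hm (1 : ℝ)) q := by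
    rw [L2.inner_indicatorConstLp_one, prim, intervalIntegral.integral_of_le hx.1,
      integral_Ioc_eq_integral_Ioo, hr]
  rw [e]
  refine (abs_real_inner_le_norm _ _).trans (mul_le_of_le_one_left (norm_nonneg _) ?_)
  rw [norm_indicatorConstLp (by norm_num) (by norm_num), norm_one, one_mul]
  refine Real.rpow_le_one measureReal_nonneg ?_ (by positivity)
  rw [measureReal_def, vol01, Measure.restrict_apply measurableSet_Ioo,
    inter_eq_left.2 (Ioo_subset_Ioo_right hx.2), Real.volume_Ioo, sub_zero,
    ENNReal.toReal_ofReal hx.1]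
  exact hx.2

lemma prim_add (q r : L2) {x : ℝ} (hx : x ∈ Icc (0 : ℝ) 1) :
    prim (q + r : L2) x = prim q x + prim r x := by
  have h0 : (0 : ℝ) ∈ Icc (0 : ℝ) 1 := by simp
  rw [prim, prim, prim, ← intervalIntegral.integral_add (intervalIntegrable_L2 q h0 hx)
    (intervalIntegrable_L2 r h0 hx)]
  refine intervalIntegral.integral_congr_ae_restrict ?_
  rw [uIoc_of_le hx.1, ← restrict_Ioo_eq_restrict_Ioc]
  exact ae_restrict_of_ae_restrict_of_subset (Ioo_subset_Ioo_right hx.2) (Lp.coeFn_add q r)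

lemma prim_smul (k : ℝ) (q : L2) {x : ℝ} (hx : x ∈ Icc (0 : ℝ) 1) :
    prim (k • q : L2) x = k * prim q x := by
  rw [prim, prim, ← intervalIntegral.integral_const_mul]
  refine intervalIntegral.integral_congr_ae_restrict ?_
  rw [uIoc_of_le hx.1, ← restrict_Ioo_eq_restrict_Ioc]
  exact ae_restrict_of_ae_restrict_of_subset (Ioo_subset_Ioo_right hx.2) (Lp.coeFn_smul k q)

lemma intervalIntegrable_prim (q : L2) {c d : ℝ} (hc : c ∈ Icc (0 : ℝ) 1)
    (hd : d ∈ Icc (0 : ℝ) 1) : IntervalIntegrable (prim q) volume c d :=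
  ((continuousOn_prim q).mono (ordConnected_Icc.uIcc_subset hc hd)).intervalIntegrable

/-- The second primitive of `q` that vanishes to second order at `0`. -/
noncomputable def prim2 (q : ℝ → ℝ) (x : ℝ) : ℝ := ∫ s in (0 : ℝ)..x, prim q s

lemma isPrim_prim2 (q : L2) : IsPrim 0 1 (prim2 q) (prim q) :=
  IsPrim.primitive (intervalIntegrable_prim q (by simp) (by simp)) (by simp)

lemma continuousOn_prim2 (q : L2) : ContinuousOn (prim2 q) (Icc 0 1) := by
  simpa using (isPrim_prim2 q).continuousOn

/-- The factor x compensates the singularity of 1/a: it puts the second primitive into L²_{1/a},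
because x²/a is bounded. -/
lemma abs_prim2_le (q : L2) {x : ℝ} (hx : x ∈ Icc (0 : ℝ) 1) : |prim2 q x| ≤ x * ‖q‖ := by
  have := intervalIntegral.norm_integral_le_of_norm_le_const (a := 0) (b := x) (f := prim q)
    (C := ‖q‖) fun y hy => by
      rw [uIoc_of_le hx.1] at hy
      exact abs_prim_le q ⟨hy.1.le, hy.2.trans hx.2⟩
  rwa [sub_zero, abs_of_nonneg hx.1, mul_comm] at this

lemma prim2_add (q r : L2) {x : ℝ} (hx : x ∈ Icc (0 : ℝ) 1) :
    prim2 (q + r : L2) x = prim2 q x + prim2 r x := by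
  have h0 : (0 : ℝ) ∈ Icc (0 : ℝ) 1 := by simp
  rw [prim2, prim2, prim2, ← intervalIntegral.integral_add (intervalIntegrable_prim q h0 hx)
    (intervalIntegrable_prim r h0 hx)]
  refine intervalIntegral.integral_congr fun s hs => prim_add q r ?_
  rw [uIcc_of_le hx.1] at hs
  exact ⟨hs.1, hs.2.trans hx.2⟩

lemma prim2_smul (k : ℝ) (q : L2) {x : ℝ} (hx : x ∈ Icc (0 : ℝ) 1) :
    prim2 (k • q : L2) x = k * prim2 q x := by
  rw [prim2, prim2, ← intervalIntegral.integral_const_mul]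
  refine intervalIntegral.integral_congr fun s hs => prim_smul k q ?_
  rw [uIcc_of_le hx.1] at hs
  exact ⟨hs.1, hs.2.trans hx.2⟩

/-- Evaluation of the primitive at `1`. -/
noncomputable def evPrim : L2 →L[ℝ] ℝ :=
  LinearMap.mkContinuous
    { toFun := fun q => prim q 1
      map_add' := fun q r => prim_add q r (by simp)
      map_smul' := fun k q => prim_smul k q (by simp) } 1
    fun q => by simpa using abs_prim_le q (x := 1) (by simp)

/-- Evaluation of the second primitive at `1`. -/
noncomputable def evPrim2 : L2 →L[ℝ] ℝ :=
  LinearMap.mkContinuous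
    { toFun := fun q => prim2 q 1
      map_add' := fun q r => prim2_add q r (by simp)
      map_smul' := fun k q => prim2_smul k q (by simp) } 1
    fun q => by simpa using abs_prim2_le q (x := 1) (by simp)

@[simp] lemma evPrim_apply (q : L2) : evPrim q = prim q 1 := rfl

@[simp] lemma evPrim2_apply (q : L2) : evPrim2 q = prim2 q 1 := rfl

lemma inner_L2_eq (q r : L2) : inner ℝ q r = ∫ x in (0 : ℝ)..1, q x * r x := by
  rw [L2.inner_def, intervalIntegral.integral_of_le zero_le_one, integral_Ioc_eq_integral_Ioo]
  exact integral_congr_ae (Eventually.of_forall fun x => mul_comm _ _)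

lemma intervalIntegrable_mul_L2 (q r : L2) : IntervalIntegrable (fun x => q x * r x) volume 0 1 := by
  rw [intervalIntegrable_iff_integrableOn_Ioo_of_le zero_le_one]
  exact (Lp.memLp q).integrable_mul (Lp.memLp r)

/-! ### The weight -/

/-- The properties of the coefficient `a` common to both kinds of degeneracy. -/
structure IsWeight (a : ℝ → ℝ) (K : ℝ) : Prop where
  contDiffOn : ContDiffOn ℝ 1 a (Ioc 0 1)
  pos : ∀ x ∈ Ioc (0 : ℝ) 1, 0 < a x
  bound : ∀ x ∈ Ioo (0 : ℝ) 1, x * |deriv a x| ≤ K * a x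
  K_pos : 0 < K
  K_lt : K < 2

/-- A nonzero `degConst a` certifies that the set of quotients is bounded above, because the real
supremum of an unbounded set is 0. -/
lemma mul_abs_deriv_le {a : ℝ → ℝ} (hpos : ∀ x ∈ Ioc (0 : ℝ) 1, 0 < a x) (hK : degConst a ≠ 0) :
    ∀ x ∈ Ioo (0 : ℝ) 1, x * |deriv a x| ≤ degConst a * a x := by
  intro x hx
  have hx' : x ∈ Ioc (0 : ℝ) 1 := ⟨hx.1, hx.2.le⟩
  have hb : BddAbove ((fun x : ℝ => x * |derivWithin a (Ioc 0 1) x| / a x) '' Ioc 0 1) := by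
    by_contra h
    exact hK (Real.sSup_of_not_bddAbove h)
  have := le_csSup hb (mem_image_of_mem _ hx')
  rw [div_le_iff₀ (hpos x hx'),
    derivWithin_of_mem_nhds (Ioc_mem_nhds hx.1 hx.2)] at this
  exact this

lemma isWeight_degConst {a : ℝ → ℝ} (ha : WeaklyDegenerate a ∨ StronglyDegenerate a) :
    IsWeight a (degConst a) := by
  rcases ha with h | h
  · exact ⟨h.contDiffOn, h.pos, mul_abs_deriv_le h.pos h.const_mem.1.ne', h.const_mem.1,
      h.const_mem.2.trans one_lt_two⟩
  · have h0 : 0 < degConst a := zero_lt_one.trans_le h.const_mem.1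
    exact ⟨h.contDiffOn.mono Ioc_subset_Icc_self, h.pos, mul_abs_deriv_le h.pos h0.ne', h0,
      h.const_mem.2⟩

section Weight

variable {a : ℝ → ℝ} {K : ℝ}

lemma IsWeight.a1_pos (hw : IsWeight a K) : 0 < a 1 := hw.pos 1 (by simp)

lemma IsWeight.hasDerivAt (hw : IsWeight a K) {x : ℝ} (hx : x ∈ Ioo (0 : ℝ) 1) :
    HasDerivAt a (deriv a x) x :=
  ((hw.contDiffOn.differentiableOn one_ne_zero x ⟨hx.1, hx.2.le⟩).differentiableAt
    (Ioc_mem_nhds hx.1 hx.2)).hasDerivAt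

/-- The function x²/a is nondecreasing: its derivative has the sign of 2a - x a', and x a' ≤ K a
with K < 2. -/
lemma IsWeight.sq_div_le (hw : IsWeight a K) {x : ℝ} (hx : x ∈ Ioc (0 : ℝ) 1) :
    x ^ 2 / a x ≤ 1 / a 1 := by
  have hne : ∀ x ∈ Ioc (0 : ℝ) 1, a x ≠ 0 := fun x hx => (hw.pos x hx).ne'
  have hd : ∀ x ∈ Ioo (0 : ℝ) 1, HasDerivAt (fun x => x ^ 2 / a x)
      ((2 * x * a x - x ^ 2 * deriv a x) / a x ^ 2) x := fun x hx => by
    simpa using (hasDerivAt_pow 2 x).fun_div (hw.hasDerivAt hx) (hne x ⟨hx.1, hx.2.le⟩)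
  have hmono : MonotoneOn (fun x => x ^ 2 / a x) (Ioc 0 1) := by
    refine monotoneOn_of_deriv_nonneg (convex_Ioc 0 1)
      ((continuousOn_id.pow 2).div hw.contDiffOn.continuousOn hne) ?_ ?_
    · rw [interior_Ioc]
      exact fun x hx => (hd x hx).differentiableAt.differentiableWithinAt
    · rw [interior_Ioc]
      intro x hx
      rw [(hd x hx).deriv]
      have h1 := hw.bound x hx
      have h2 := hw.pos x ⟨hx.1, hx.2.le⟩
      have h3 : x * deriv a x ≤ 2 * a x := by
        have := mul_le_mul_of_nonneg_left (le_abs_self (deriv a x)) hx.1.le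
        nlinarith [hw.K_lt]
      refine div_nonneg ?_ (sq_nonneg _)
      nlinarith [mul_le_mul_of_nonneg_left h3 hx.1.le]
  simpa using hmono hx (by simp) hx.2

lemma IsWeight.inv_le (hw : IsWeight a K) {x : ℝ} (hx : x ∈ Ioc (0 : ℝ) 1) :
    1 / a x ≤ 1 / a 1 / x ^ 2 := by
  have h := hw.sq_div_le hx
  have h2 : 0 < x ^ 2 := pow_pos hx.1 2
  rw [le_div_iff₀ h2]
  calc 1 / a x * x ^ 2 = x ^ 2 / a x := by ring
    _ ≤ _ := h

lemma IsWeight.aemeasurable (hw : IsWeight a K) :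
    AEMeasurable (fun x => ENNReal.ofReal (1 / a x)) vol01 := by
  have : AEMeasurable a vol01 := (hw.contDiffOn.continuousOn.mono Ioo_subset_Ioc_self).aemeasurable
    measurableSet_Ioo
  exact (this.const_div 1).ennreal_ofReal

lemma wvol_absolutelyContinuous (a : ℝ → ℝ) : wvol a ≪ vol01 := withDensity_absolutelyContinuous _ _

/-- The density 1/a is positive on (0,1), so the weighted and unweighted measures have the same null
sets and almost-everywhere statements move freely between them. -/
lemma IsWeight.absolutelyContinuous (hw : IsWeight a K) : vol01 ≪ wvol a := by
  refine withDensity_absolutelyContinuous' hw.aemeasurable ?_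
  filter_upwards [ae_vol01_mem] with x hx
  have := hw.pos x ⟨hx.1, hx.2.le⟩
  simp only [ne_eq, ENNReal.ofReal_eq_zero, not_le]
  positivity

lemma IsWeight.ae_eq_vol01 (hw : IsWeight a K) {f g : ℝ → ℝ} (h : f =ᵐ[wvol a] g) :
    f =ᵐ[vol01] g := hw.absolutelyContinuous.ae_eq h

lemma IsWeight.integrable_iff (hw : IsWeight a K) {g : ℝ → ℝ} :
    Integrable g (wvol a) ↔ IntervalIntegrable (fun x => g x / a x) volume 0 1 := by
  rw [wvol, integrable_withDensity_iff_integrable_smul₀' hw.aemeasurable (by simp),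
    intervalIntegrable_iff_integrableOn_Ioo_of_le zero_le_one, IntegrableOn, ← vol01]
  refine integrable_congr ?_
  filter_upwards [ae_vol01_mem] with x hx
  have := hw.pos x ⟨hx.1, hx.2.le⟩
  rw [ENNReal.toReal_ofReal (by positivity), smul_eq_mul]; ring

lemma IsWeight.integral_eq (hw : IsWeight a K) (g : ℝ → ℝ) :
    ∫ x, g x ∂wvol a = ∫ x in (0 : ℝ)..1, g x / a x := by
  rw [wvol, integral_withDensity_eq_integral_toReal_smul₀ hw.aemeasurable (by simp),
    intervalIntegral.integral_of_le zero_le_one, integral_Ioc_eq_integral_Ioo, ← vol01]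
  refine integral_congr_ae ?_
  filter_upwards [ae_vol01_mem] with x hx
  have := hw.pos x ⟨hx.1, hx.2.le⟩
  rw [ENNReal.toReal_ofReal (by positivity), smul_eq_mul]; ring

lemma IsWeight.inner_eq (hw : IsWeight a K) (f g : L2w a) :
    inner ℝ f g = ∫ x in (0 : ℝ)..1, f x * g x / a x := by
  rw [L2.inner_def, ← hw.integral_eq]
  exact integral_congr_ae (Eventually.of_forall fun x => mul_comm _ _)

lemma IsWeight.intervalIntegrable_mul (hw : IsWeight a K) (f g : L2w a) :
    IntervalIntegrable (fun x => f x * g x / a x) volume 0 1 :=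
  hw.integrable_iff.1 ((Lp.memLp f).integrable_mul (Lp.memLp g))

/-- Functions bounded by `C x` belong to `L²_{1/a}`. -/
lemma IsWeight.memLp_of_bound (hw : IsWeight a K) {F : ℝ → ℝ} (hF : ContinuousOn F (Icc 0 1))
    {C : ℝ} (hC : ∀ x ∈ Icc (0 : ℝ) 1, |F x| ≤ x * C) : MemLp F 2 (wvol a) := by
  have hm : AEStronglyMeasurable F vol01 :=
    (hF.mono Ioo_subset_Icc_self).aestronglyMeasurable measurableSet_Ioo
  have ham : AEStronglyMeasurable a vol01 :=
    (hw.contDiffOn.continuousOn.mono Ioo_subset_Ioc_self).aestronglyMeasurable measurableSet_Ioo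
  rw [memLp_two_iff_integrable_sq (hm.mono_ac (wvol_absolutelyContinuous a)), hw.integrable_iff,
    intervalIntegrable_iff_integrableOn_Ioo_of_le zero_le_one]
  refine Integrable.of_bound (C := C ^ 2 / a 1) ?_ ?_
  · exact ((hm.pow 2).aemeasurable.div ham.aemeasurable).aestronglyMeasurable
  · filter_upwards [ae_vol01_mem] with x hx
    have h0 := hw.pos x ⟨hx.1, hx.2.le⟩
    have h1 := hw.sq_div_le ⟨hx.1, hx.2.le⟩
    rw [Real.norm_of_nonneg (by positivity)]
    have h2 : F x ^ 2 ≤ (x * C) ^ 2 := sq_le_sq' (by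
      have := neg_abs_le (F x); linarith [hC x ⟨hx.1.le, hx.2.le⟩])
      ((le_abs_self _).trans (hC x ⟨hx.1.le, hx.2.le⟩))
    calc F x ^ 2 / a x ≤ (x * C) ^ 2 / a x := by gcongr
      _ = C ^ 2 * (x ^ 2 / a x) := by ring
      _ ≤ C ^ 2 * (1 / a 1) := by gcongr
      _ = _ := by ring

/-- Integrate F²/a ≤ C² x²/a ≤ C²/a(1) over (0,1). -/
lemma IsWeight.norm_le_of_bound (hw : IsWeight a K) {F : ℝ → ℝ} {f : L2w a} (hf : f =ᵐ[vol01] F)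
    {C : ℝ} (hC0 : 0 ≤ C) (hC : ∀ x ∈ Icc (0 : ℝ) 1, |F x| ≤ x * C) :
    ‖f‖ ≤ 1 / √(a 1) * C := by
  have ha1 := hw.a1_pos
  have h : ‖f‖ ^ 2 ≤ C ^ 2 / a 1 := by
    rw [← real_inner_self_eq_norm_sq, hw.inner_eq]
    have e : C ^ 2 / a 1 = ∫ x in (0 : ℝ)..1, C ^ 2 / a 1 := by simp
    rw [e]
    refine intervalIntegral.integral_mono_ae_restrict zero_le_one
      (hw.intervalIntegrable_mul f f) (by simp) ?_
    rw [← Measure.restrict_congr_set Ioo_ae_eq_Icc]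
    filter_upwards [hf, ae_vol01_mem] with x hx hm
    have h0 := hw.pos x ⟨hm.1, hm.2.le⟩
    have h1 := hw.sq_div_le ⟨hm.1, hm.2.le⟩
    have h2 : F x ^ 2 ≤ (x * C) ^ 2 := sq_le_sq' (by
      have := neg_abs_le (F x); linarith [hC x ⟨hm.1.le, hm.2.le⟩])
      ((le_abs_self _).trans (hC x ⟨hm.1.le, hm.2.le⟩))
    rw [hx]
    calc F x * F x / a x = F x ^ 2 / a x := by ring
      _ ≤ (x * C) ^ 2 / a x := by gcongr
      _ = C ^ 2 * (x ^ 2 / a x) := by ring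
      _ ≤ C ^ 2 * (1 / a 1) := by gcongr
      _ = _ := by ring
  refine abs_le_of_sq_le_sq' ?_ (by positivity) |>.2
  rw [mul_pow, div_pow, Real.sq_sqrt ha1.le]
  calc ‖f‖ ^ 2 ≤ C ^ 2 / a 1 := h
    _ = _ := by ring

/-! ### The bounded operators J : u'' ↦ u and P : u'' ↦ x u' -/

/-- A linear integral operator with `|F q x| ≤ x ‖q‖` defines a bounded operator from `L²` to
`L²_{1/a}`. -/
lemma IsWeight.exists_operator (hw : IsWeight a K) (F : L2 → ℝ → ℝ)
    (hadd : ∀ q r, ∀ x ∈ Icc (0 : ℝ) 1, F (q + r) x = F q x + F r x)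
    (hsmul : ∀ (k : ℝ) q, ∀ x ∈ Icc (0 : ℝ) 1, F (k • q) x = k * F q x)
    (hcont : ∀ q, ContinuousOn (F q) (Icc 0 1))
    (hb : ∀ q, ∀ x ∈ Icc (0 : ℝ) 1, |F q x| ≤ x * ‖q‖) :
    ∃ L : L2 →L[ℝ] L2w a, (∀ q, L q =ᵐ[vol01] F q) ∧ ∀ q, ‖L q‖ ≤ 1 / √(a 1) * ‖q‖ := by
  have hmem : ∀ q, MemLp (F q) 2 (wvol a) := fun q => hw.memLp_of_bound (hcont q) (hb q)
  have hcoe : ∀ q, ((hmem q).toLp (F q) : ℝ → ℝ) =ᵐ[vol01] F q := fun q =>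
    hw.ae_eq_vol01 (hmem q).coeFn_toLp
  have hn : ∀ q, ‖(hmem q).toLp (F q)‖ ≤ 1 / √(a 1) * ‖q‖ := fun q =>
    hw.norm_le_of_bound (hcoe q) (norm_nonneg q) (hb q)
  have hmeme : ∀ᵐ x ∂wvol a, x ∈ Icc (0 : ℝ) 1 :=
    (wvol_absolutelyContinuous a).ae_le (ae_vol01_mem.mono fun x hx => ⟨hx.1.le, hx.2.le⟩)
  refine ⟨LinearMap.mkContinuous
    { toFun := fun q => (hmem q).toLp (F q)
      map_add' := fun q r => ?_
      map_smul' := fun k q => ?_ } (1 / √(a 1)) hn, hcoe, hn⟩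
  · rw [← MemLp.toLp_add]
    refine MemLp.toLp_congr _ _ ?_
    filter_upwards [hmeme] with x hx using hadd q r x hx
  · rw [RingHom.id_apply, ← MemLp.toLp_const_smul]
    refine MemLp.toLp_congr _ _ ?_
    filter_upwards [hmeme] with x hx using hsmul k q x hx

lemma IsWeight.exists_opJ (hw : IsWeight a K) : ∃ L : L2 →L[ℝ] L2w a,
    (∀ q, L q =ᵐ[vol01] prim2 q) ∧ ∀ q, ‖L q‖ ≤ 1 / √(a 1) * ‖q‖ :=
  hw.exists_operator (fun q => prim2 q) (fun q r _ hx => prim2_add q r hx)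
    (fun k q _ hx => prim2_smul k q hx) continuousOn_prim2 fun q _ hx => abs_prim2_le q hx

lemma IsWeight.exists_opP (hw : IsWeight a K) : ∃ L : L2 →L[ℝ] L2w a,
    (∀ q, L q =ᵐ[vol01] fun x => x * prim q x) ∧ ∀ q, ‖L q‖ ≤ 1 / √(a 1) * ‖q‖ :=
  hw.exists_operator (fun q x => x * prim q x)
    (fun q r x hx => by simp only [prim_add q r hx]; ring)
    (fun k q x hx => by simp only [prim_smul k q hx]; ring)
    (fun q => continuousOn_id.mul (continuousOn_prim q)) fun q x hx => by
      rw [abs_mul, abs_of_nonneg hx.1]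
      exact mul_le_mul_of_nonneg_left (abs_prim_le q hx) hx.1

/-- The operator that recovers `u` from `u''`, for `u` vanishing to second order at `0`. -/
noncomputable def IsWeight.opJ (hw : IsWeight a K) : L2 →L[ℝ] L2w a := hw.exists_opJ.choose

/-- The operator that maps `u''` to `x u'`, for `u'` vanishing at `0`. -/
noncomputable def IsWeight.opP (hw : IsWeight a K) : L2 →L[ℝ] L2w a := hw.exists_opP.choose

lemma IsWeight.opJ_ae (hw : IsWeight a K) (q : L2) : hw.opJ q =ᵐ[vol01] prim2 q :=
  hw.exists_opJ.choose_spec.1 q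

lemma IsWeight.norm_opJ_le (hw : IsWeight a K) (q : L2) : ‖hw.opJ q‖ ≤ 1 / √(a 1) * ‖q‖ :=
  hw.exists_opJ.choose_spec.2 q

lemma IsWeight.opP_ae (hw : IsWeight a K) (q : L2) : hw.opP q =ᵐ[vol01] fun x => x * prim q x :=
  hw.exists_opP.choose_spec.1 q

lemma IsWeight.norm_opP_le (hw : IsWeight a K) (q : L2) : ‖hw.opP q‖ ≤ 1 / √(a 1) * ‖q‖ :=
  hw.exists_opP.choose_spec.2 q

/-! ### The space H²_{1/a} described by second derivatives -/

lemma L2w_ext {f g : L2w a} (h : f =ᵐ[vol01] g) : f = g :=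
  Lp.ext ((wvol_absolutelyContinuous a).ae_eq h)

lemma locallyIntegrableOn_L2 (q : L2) : LocallyIntegrableOn q (Ioo 0 1) :=
  (integrableOn_L2 q).locallyIntegrableOn

lemma isPrim_of_le {F f : ℝ → ℝ} (h : IsPrim 0 1 F f) {δ : ℝ} (hδ : 0 < δ) (hδ' : δ < 1 / 2) :
    IsPrim δ (1 - δ) F f :=
  h.mono (by
    rw [uIcc_of_le zero_le_one, uIcc_of_le (by linarith)]
    exact Icc_subset_Icc hδ.le (by linarith))

lemma hasWeakDeriv_prim (q : L2) : HasWeakDeriv 1 (prim q) q := by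
  have hl : LocallyIntegrableOn (prim q) (Ioo 0 1) :=
    locallyIntegrableOn_of_isPrim fun δ h1 h2 => isPrim_of_le (isPrim_prim q) h1 h2
  exact (hasWeakDeriv_zero_iff.2 ⟨hl, EventuallyEq.rfl⟩).succ
    (fun δ h1 h2 => isPrim_of_le (isPrim_prim q) h1 h2) (locallyIntegrableOn_L2 q)

lemma hasWeakDeriv_prim2 (q : L2) :
    HasWeakDeriv 1 (prim2 q) (prim q) ∧ HasWeakDeriv 2 (prim2 q) q := by
  have hl : LocallyIntegrableOn (prim2 q) (Ioo 0 1) :=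
    locallyIntegrableOn_of_isPrim fun δ h1 h2 => isPrim_of_le (isPrim_prim2 q) h1 h2
  have h1 : HasWeakDeriv 1 (prim2 q) (prim q) :=
    (hasWeakDeriv_zero_iff.2 ⟨hl, EventuallyEq.rfl⟩).succ
      (fun δ h1 h2 => isPrim_of_le (isPrim_prim2 q) h1 h2) (hasWeakDeriv_prim q).1
  exact ⟨h1, h1.succ (fun δ h1 h2 => isPrim_of_le (isPrim_prim q) h1 h2)
    (locallyIntegrableOn_L2 q)⟩

/-- A function with weak derivative `q`, continuous up to the boundary, that vanishes at both
ends. -/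
lemma HasWeakDeriv.eq_integral {u g G : ℝ → ℝ} (h : HasWeakDeriv 1 u g)
    (hG : IsPrim 0 1 G g) (hG0 : G 0 = 0) (h0 : HasBdryValue u 0 0) (h1 : HasBdryValue u 1 0) :
    u =ᵐ[vol01] G ∧ G 1 = 0 := by
  obtain ⟨c, hc⟩ := h.exists_lower
  have hu := (hasWeakDeriv_zero_iff.1 hc).2
  have hGc : ContinuousOn G (Icc 0 1) := by simpa using hG.continuousOn
  have e : ∀ x ∈ Ioo (0 : ℝ) 1, (∫ s in (1 / 2 : ℝ)..x, g s) = G x - G (1 / 2) := by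
    intro x hx
    refine (hG.mono ?_).integral_eq
    rw [uIcc_of_le zero_le_one]
    exact ordConnected_Icc.uIcc_subset (by norm_num) ⟨hx.1.le, hx.2.le⟩
  have hu' : u =ᵐ[vol01] fun x => G x + (c - G (1 / 2)) := by
    filter_upwards [hu, ae_vol01_mem] with x hx hm
    rw [hx, e x hm]; ring
  have hcont : ContinuousOn (fun x => G x + (c - G (1 / 2))) (Icc 0 1) :=
    hGc.add continuousOn_const
  have z0 := (h0.congr hu').unique (by simp) (hasBdryValue_of_continuousOn hcont (by simp))
  have z1 := (h1.congr hu').unique (by simp) (hasBdryValue_of_continuousOn hcont (by simp))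
  simp only [hG0, zero_add] at z0
  refine ⟨?_, by rw [← z0, add_zero] at z1; exact z1.symm⟩
  filter_upwards [hu'] with x hx
  rw [hx, ← z0, add_zero]

/-- The space `H²_{1/a}` in terms of the second derivative. -/
lemma IsWeight.inH2_iff (hw : IsWeight a K) {u : L2w a} {q : L2} :
    InH2 a u q ↔ u = hw.opJ q ∧ evPrim q = 0 ∧ evPrim2 q = 0 := by
  constructor
  · rintro ⟨-, p, h1, h2, hu0, hu1, hp0, hp1⟩
    obtain ⟨c, hc⟩ := h2.exists_lower
    have hpc := hc.unique h1
    -- Lowering the order shows that p is a primitive of q up to a constant. The values at 0 then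
    -- fix the constants of integration for p and u, and those at 1 become the two linear
    -- constraints on q.
    have hpw : HasWeakDeriv 1 p q := by
      have hl := hc.2.1
      exact ((hasWeakDeriv_zero_iff.2 ⟨hl, EventuallyEq.rfl⟩).succ
        (fun δ h1 h2 => isPrim_integral_half (locallyIntegrableOn_L2 q) c h1 h2)
        (locallyIntegrableOn_L2 q)).congr hpc EventuallyEq.rfl
    obtain ⟨hp, hp1'⟩ := hpw.eq_integral (isPrim_prim q) (by simp [prim]) hp0 hp1
    obtain ⟨hu, hu1'⟩ := (h1.congr EventuallyEq.rfl hp).eq_integral (isPrim_prim2 q)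
      (by simp [prim2]) hu0 hu1
    exact ⟨L2w_ext (hu.trans (hw.opJ_ae q).symm), hp1', hu1'⟩
  · rintro ⟨rfl, h1, h2⟩
    rw [evPrim_apply] at h1
    rw [evPrim2_apply] at h2
    have hu := hw.opJ_ae q
    have hm : ∀ {F : ℝ → ℝ}, ContinuousOn F (Icc 0 1) → MemLp F 2 vol01 := by
      intro F hF
      obtain ⟨C, hC⟩ := isCompact_Icc.exists_bound_of_continuousOn hF
      refine MemLp.of_bound ((hF.mono Ioo_subset_Icc_self).aestronglyMeasurable
        measurableSet_Ioo) C ?_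
      filter_upwards [ae_vol01_mem] with x hx using hC x ⟨hx.1.le, hx.2.le⟩
    have hp := (hm (continuousOn_prim q)).coeFn_toLp
    refine ⟨(memLp_congr_ae hu).2 (hm (continuousOn_prim2 q)),
      (hm (continuousOn_prim q)).toLp _,
      (hasWeakDeriv_prim2 q).1.congr hu.symm hp.symm,
      (hasWeakDeriv_prim2 q).2.congr hu.symm EventuallyEq.rfl, ?_, ?_, ?_, ?_⟩
    · refine HasBdryValue.congr ?_ hu.symm
      simpa [prim2] using hasBdryValue_of_continuousOn (continuousOn_prim2 q) (x₀ := 0) (by simp)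
    · refine HasBdryValue.congr ?_ hu.symm
      simpa [h2] using hasBdryValue_of_continuousOn (continuousOn_prim2 q) (x₀ := 1) (by simp)
    · refine HasBdryValue.congr ?_ hp.symm
      simpa [prim] using hasBdryValue_of_continuousOn (continuousOn_prim q) (x₀ := 0) (by simp)
    · refine HasBdryValue.congr ?_ hp.symm
      simpa [h1] using hasBdryValue_of_continuousOn (continuousOn_prim q) (x₀ := 1) (by simp)

end Weight

/-! ### Calculus on (0,1] and smooth elements of H² -/

lemma ae_uIcc_of_ae_vol01 {P : ℝ → Prop} (h : ∀ᵐ x ∂vol01, P x) {δ : ℝ} (hδ : δ ∈ Ioo (0 : ℝ) 1) :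
    ∀ᵐ x, x ∈ uIcc δ 1 → P x := by
  rw [vol01, ae_restrict_iff' measurableSet_Ioo] at h
  have h1 : ∀ᵐ x : ℝ, x ≠ 1 := by simp [ae_iff, measure_singleton]
  filter_upwards [h, h1] with x hx hx1 hm
  rw [uIcc_of_le hδ.2.le] at hm
  exact hx ⟨hδ.1.trans_le hm.1, lt_of_le_of_ne hm.2 hx1⟩

lemma IsPrim.of_zero_one {F f : ℝ → ℝ} (h : IsPrim 0 1 F f) {δ : ℝ} (hδ : δ ∈ Ioo (0 : ℝ) 1) :
    IsPrim δ 1 F f :=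
  h.mono (by
    rw [uIcc_of_le zero_le_one, uIcc_of_le hδ.2.le]
    exact Icc_subset_Icc_left hδ.1.le)

/-- The fundamental theorem of calculus on `(0, 1]`. -/
lemma integral_eq_of_isPrim_of_tendsto {G h : ℝ → ℝ} (hh : IntervalIntegrable h volume 0 1)
    (hG : ∀ δ ∈ Ioo (0 : ℝ) 1, IsPrim δ 1 G h) (h0 : Tendsto G (𝓝[>] 0) (𝓝 0)) :
    ∫ x in (0 : ℝ)..1, h x = G 1 := by
  have hc : Tendsto (fun x => ∫ s in (0 : ℝ)..x, h s) (𝓝[>] 0) (𝓝 0) := by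
    have h1 := (IsPrim.primitive hh left_mem_uIcc).continuousOn 0 left_mem_uIcc
    have h2 : Tendsto (fun x => ∫ s in (0 : ℝ)..x, h s) (𝓝[uIcc 0 1] 0) (𝓝 0) := by
      simpa [ContinuousWithinAt] using h1
    refine h2.mono_left ?_
    rw [uIcc_of_le zero_le_one, ← nhdsWithin_Ioo_eq_nhdsGT (zero_lt_one' ℝ)]
    exact nhdsWithin_mono _ Ioo_subset_Icc_self
  have e : (fun x => (∫ s in (0 : ℝ)..1, h s) - ∫ s in (0 : ℝ)..x, h s) =ᶠ[𝓝[>] 0]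
      fun x => G 1 - G x := by
    filter_upwards [Ioo_mem_nhdsGT (zero_lt_one' ℝ)] with x hx
    have hs := intervalIntegral.integral_add_adjacent_intervals
      (hh.mono_set (c := 0) (d := x) (by
        rw [uIcc_of_le hx.1.le, uIcc_of_le zero_le_one]; exact Icc_subset_Icc_right hx.2.le))
      (hG x hx).intervalIntegrable
    rw [← (hG x hx).integral_eq, ← hs]; ring
  have t1 := (tendsto_const_nhds (x := ∫ s in (0 : ℝ)..1, h s)).sub hc
  have t2 := (tendsto_const_nhds (x := G 1)).sub h0
  simpa using tendsto_nhds_unique (t1.congr' e) t2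

lemma prim_congr {q g : ℝ → ℝ} (h : q =ᵐ[vol01] g) {x : ℝ} (hx : x ∈ Icc (0 : ℝ) 1) :
    prim q x = prim g x := by
  refine intervalIntegral.integral_congr_ae_restrict ?_
  rw [uIoc_of_le hx.1, ← restrict_Ioo_eq_restrict_Ioc]
  exact ae_restrict_of_ae_restrict_of_subset (Ioo_subset_Ioo_right hx.2) h

/-- A square integrable function is determined by prescribing a smooth second primitive. -/
lemma exists_L2_of_contDiff {φ : ℝ → ℝ} (hφ : ContDiff ℝ 2 φ) (h0 : φ 0 = 0) (h1 : deriv φ 0 = 0) :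
    ∃ r : L2, r =ᵐ[vol01] iteratedDeriv 2 φ ∧ (∀ x ∈ Icc (0 : ℝ) 1, prim r x = deriv φ x) ∧
      ∀ x ∈ Icc (0 : ℝ) 1, prim2 r x = φ x := by
  have hd2 : iteratedDeriv 2 φ = deriv (deriv φ) := by
    rw [iteratedDeriv_succ, iteratedDeriv_one]
  have hc2 : Continuous (deriv (deriv φ)) := by
    rw [← hd2]; exact hφ.continuous_iteratedDeriv 2 le_rfl
  have hφ1 : ContDiff ℝ 1 (deriv φ) := by
    have : ContDiff ℝ (1 + 1) φ := by rwa [one_add_one_eq_two]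
    exact (contDiff_succ_iff_deriv.1 this).2.2
  obtain ⟨C, hC⟩ := isCompact_Icc.exists_bound_of_continuousOn (s := Icc (0 : ℝ) 1) hc2.continuousOn
  have hm : MemLp (deriv (deriv φ)) 2 vol01 := by
    refine MemLp.of_bound hc2.aestronglyMeasurable C ?_
    filter_upwards [ae_vol01_mem] with x hx using hC x ⟨hx.1.le, hx.2.le⟩
  have hp : ∀ x ∈ Icc (0 : ℝ) 1, prim (hm.toLp _) x = deriv φ x := by
    intro x hx
    rw [prim_congr hm.coeFn_toLp hx, prim, (IsPrim.of_contDiff hφ1).integral_eq, h1, sub_zero]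
  refine ⟨hm.toLp _, by rw [hd2]; exact hm.coeFn_toLp, hp, fun x hx => ?_⟩
  have e : prim2 (hm.toLp _) x = ∫ s in (0 : ℝ)..x, deriv φ s := by
    refine intervalIntegral.integral_congr fun s hs => hp s ?_
    rw [uIcc_of_le hx.1] at hs
    exact ⟨hs.1, hs.2.trans hx.2⟩
  rw [e, (IsPrim.of_contDiff (hφ.of_le one_le_two)).integral_eq, h0, sub_zero]

/-- A function `v` with `v(0) = v'(0) = v(1) = 0` and `v'(1) = 1`. -/
lemma exists_evPrim_eq_one : ∃ ρ : L2, evPrim ρ = 1 ∧ evPrim2 ρ = 0 := by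
  have hd : deriv (fun x : ℝ => x ^ 3 - x ^ 2) = fun x => 3 * x ^ 2 - 2 * x := by
    funext x
    simp
  obtain ⟨ρ, -, h1, h2⟩ := exists_L2_of_contDiff (φ := fun x => x ^ 3 - x ^ 2)
    ((contDiff_id.pow 3).sub (contDiff_id.pow 2)) (by norm_num) (by rw [hd]; norm_num)
  refine ⟨ρ, ?_, ?_⟩
  · rw [evPrim_apply, h1 1 (by simp), hd]; norm_num
  · rw [evPrim2_apply, h2 1 (by simp)]; norm_num

/-! ### Regularity of elements of D(A) near the degenerate end -/

section

variable {a : ℝ → ℝ} {K : ℝ}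

lemma integral_inv_sq {x : ℝ} (hx : x ∈ Ioo (0 : ℝ) 1) :
    IntervalIntegrable (fun s : ℝ => 1 / s ^ 2) volume x 1 ∧
      ∫ s in x..1, 1 / s ^ 2 = 1 / x - 1 := by
  have hp : IsPrim x 1 (fun s : ℝ => -s⁻¹) (fun s => 1 / s ^ 2) := by
    have hne : ∀ s ∈ uIcc x 1, s ≠ 0 := fun s hs => by
      rw [uIcc_of_le hx.2.le] at hs
      exact (hx.1.trans_le hs.1).ne'
    refine IsPrim.of_contDiffOn (contDiffOn_id.inv hne).neg fun s hs => ?_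
    have := (hasDerivAt_inv (hne s ⟨hs.1.le, hs.2.le⟩)).fun_neg
    simpa using this
  refine ⟨hp.intervalIntegrable, ?_⟩
  rw [hp.integral_eq]
  simp only [inv_one, one_div]; ring

lemma IsWeight.aestronglyMeasurable_div (hw : IsWeight a K) (f : L2w a) :
    AEStronglyMeasurable (fun x => f x / a x) vol01 := by
  have h1 : AEMeasurable f vol01 :=
    ((Lp.aestronglyMeasurable f).mono_ac hw.absolutelyContinuous).aemeasurable
  have h2 : AEMeasurable a vol01 := (hw.contDiffOn.continuousOn.mono
    Ioo_subset_Ioc_self).aemeasurable measurableSet_Ioo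
  exact (h1.div h2).aestronglyMeasurable

/-- `f / a` is integrable away from `0`, with the rate given by the Cauchy-Schwarz inequality. -/
lemma IsWeight.integral_abs_div_le (hw : IsWeight a K) (f : L2w a) {x : ℝ}
    (hx : x ∈ Ioo (0 : ℝ) 1) :
    IntervalIntegrable (fun s => f s / a s) volume x 1 ∧
      ∫ s in x..1, |f s / a s| ≤ (‖f‖ ^ 2 + 1 / a 1) / √x := by
  obtain ⟨i2, e2⟩ := integral_inv_sq hx
  have hx0 := hx.1
  have hsx : 0 < √x := Real.sqrt_pos.2 hx.1
  have hff := hw.intervalIntegrable_mul f f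
  have hff' : IntervalIntegrable (fun s => f s * f s / a s) volume x 1 := hff.mono_set (by
    rw [uIcc_of_le hx.2.le, uIcc_of_le zero_le_one]; exact Icc_subset_Icc_left hx.1.le)
  have hdom : IntervalIntegrable
      (fun s => 1 / √x * (f s * f s / a s) + √x * (1 / a 1) * (1 / s ^ 2)) volume x 1 :=
    (hff'.const_mul _).add (i2.const_mul _)
  have hle : ∀ᵐ s ∂volume.restrict (Ioc x 1), |f s / a s| ≤
      1 / √x * (f s * f s / a s) + √x * (1 / a 1) * (1 / s ^ 2) := by
    filter_upwards [ae_restrict_mem measurableSet_Ioc] with s hs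
    have hs' : s ∈ Ioc (0 : ℝ) 1 := ⟨hx.1.trans hs.1, hs.2⟩
    have ha := hw.pos s hs'
    have h1 := hw.inv_le hs'
    have h2 : |f s / a s| ≤ 1 / √x * (f s * f s / a s) + √x * (1 / a s) := by
      rw [abs_div, abs_of_pos ha, ← abs_mul_abs_self (f s)]
      -- Young's inequality weighted by √x: after division by a, the integral over (x,1) of each
      -- term is of order x^{-1/2}, as 1/a(s) ≤ 1/(a(1)s²).
      have : |f s| ≤ 1 / √x * (|f s| * |f s|) + √x := by
        rw [← sub_nonneg]
        have e : 1 / √x * (|f s| * |f s|) + √x - |f s| =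
            (1 / √x) * ((|f s| - √x / 2) ^ 2 + 3 / 4 * √x ^ 2) := by
          field_simp; ring
        rw [e]; positivity
      calc |f s| / a s ≤ (1 / √x * (|f s| * |f s|) + √x) / a s := by gcongr
        _ = _ := by ring
    refine h2.trans ?_
    have : √x * (1 / a s) ≤ √x * (1 / a 1 / s ^ 2) := by gcongr
    calc _ ≤ 1 / √x * (f s * f s / a s) + √x * (1 / a 1 / s ^ 2) := by gcongr
      _ = _ := by ring
  have hi : IntervalIntegrable (fun s => f s / a s) volume x 1 := by
    rw [intervalIntegrable_iff_integrableOn_Ioc_of_le hx.2.le] at hdom ⊢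
    refine Integrable.mono' hdom ?_ hle
    rw [← restrict_Ioo_eq_restrict_Ioc]
    exact (hw.aestronglyMeasurable_div f).mono_measure
      (Measure.restrict_mono (Ioo_subset_Ioo_left hx.1.le) le_rfl)
  refine ⟨hi, ?_⟩
  calc ∫ s in x..1, |f s / a s|
      ≤ ∫ s in x..1, (1 / √x * (f s * f s / a s) + √x * (1 / a 1) * (1 / s ^ 2)) := by
        rw [intervalIntegral.integral_of_le hx.2.le, intervalIntegral.integral_of_le hx.2.le]
        rw [intervalIntegrable_iff_integrableOn_Ioc_of_le hx.2.le] at hdom hi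
        exact integral_mono_ae hi.abs hdom hle
    _ = 1 / √x * (∫ s in x..1, f s * f s / a s) + √x * (1 / a 1) * (1 / x - 1) := by
        rw [intervalIntegral.integral_add (hff'.const_mul _) (i2.const_mul _),
          intervalIntegral.integral_const_mul, intervalIntegral.integral_const_mul, e2]
    _ ≤ 1 / √x * ‖f‖ ^ 2 + √x * (1 / a 1) * (1 / x) := by
        have h1 : ∫ s in x..1, f s * f s / a s ≤ ‖f‖ ^ 2 := by
          rw [← real_inner_self_eq_norm_sq, hw.inner_eq]
          refine intervalIntegral.integral_mono_interval hx.1.le hx.2.le le_rfl ?_ hff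
          filter_upwards [ae_restrict_mem measurableSet_Ioc] with s hs
          have := hw.pos s hs
          have := mul_self_nonneg (f s)
          show 0 ≤ _
          positivity
        have h2 : √x * (1 / a 1) * (1 / x - 1) ≤ √x * (1 / a 1) * (1 / x) := by
          have := hw.a1_pos
          gcongr; linarith
        gcongr
    _ = _ := by
        have := Real.mul_self_sqrt hx.1.le
        have ha1 := hw.a1_pos
        field_simp
        nlinarith

/-- `u'' = q` is represented by a function `Q` that is bounded and absolutely continuous away
from `0`, whose derivative `t` is absolutely continuous away from `0` and satisfies
`t' = f / a`. -/
structure IsRegular (a : ℝ → ℝ) (q : L2) (f : L2w a) (t Q : ℝ → ℝ) (C : ℝ) : Prop where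
  prim_t : ∀ δ ∈ Ioo (0 : ℝ) 1, IsPrim δ 1 t (fun x => f x / a x)
  prim_Q : ∀ δ ∈ Ioo (0 : ℝ) 1, IsPrim δ 1 Q t
  ae_eq : q =ᵐ[vol01] Q
  t_le : ∀ x ∈ Ioo (0 : ℝ) 1, |t x| ≤ C / √x
  Q_le : ∀ x ∈ Ioo (0 : ℝ) 1, |Q x| ≤ C

lemma integral_const_div_sqrt_le {C x : ℝ} (hC : 0 ≤ C) (hx : x ∈ Ioo (0 : ℝ) 1) :
    IntervalIntegrable (fun s => C / √s) volume x 1 ∧ ∫ s in x..1, C / √s ≤ 2 * C := by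
  have hp : IsPrim x 1 (fun s : ℝ => 2 * C * √s) (fun s => C / √s) := by
    have hne : ∀ s ∈ uIcc x 1, s ≠ 0 := fun s hs => by
      rw [uIcc_of_le hx.2.le] at hs
      exact (hx.1.trans_le hs.1).ne'
    refine IsPrim.of_contDiffOn (contDiffOn_const.mul (contDiffOn_id.sqrt hne)) fun s hs => ?_
    have hs0 := hne s ⟨hs.1.le, hs.2.le⟩
    refine ((Real.hasDerivAt_sqrt hs0).const_mul (2 * C)).congr_deriv ?_
    field_simp
  refine ⟨hp.intervalIntegrable, ?_⟩
  rw [hp.integral_eq, Real.sqrt_one]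
  have := mul_nonneg hC (Real.sqrt_nonneg x)
  linarith

/-- Two integrations of f/a, starting at the nondegenerate end. The first primitive grows at most
like x^{-1/2}, which is integrable, so the second stays bounded up to 0. -/
lemma IsWeight.exists_isRegular (hw : IsWeight a K) {u f : L2w a} {q : L2} {g : ℝ → ℝ}
    (hu : HasWeakDeriv 2 u q) (hg : HasWeakDeriv 4 u g)
    (hf : (fun x => a x * g x) =ᵐ[vol01] f) : ∃ t Q C, IsRegular a q f t Q C := by
  have hgf : g =ᵐ[vol01] fun x => f x / a x := by
    filter_upwards [hf, ae_vol01_mem] with x hx hm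
    rw [← hx, mul_div_cancel_left₀ _ (hw.pos x ⟨hm.1, hm.2.le⟩).ne']
  replace hg := hg.congr EventuallyEq.rfl hgf
  have hii : ∀ δ ∈ Ioo (0 : ℝ) 1, IntervalIntegrable (fun s => f s / a s) volume δ 1 :=
    fun δ hδ => (hw.integral_abs_div_le f hδ).1
  have hhalf : (1 / 2 : ℝ) ∈ Ioo (0 : ℝ) 1 := by norm_num
  obtain ⟨c₃, h3⟩ := hg.exists_lower
  -- The base point moves from 1/2 to 1, which lies in [δ,1] for every δ in (0,1).
  set t : ℝ → ℝ := fun x => (∫ s in (1 : ℝ)..x, f s / a s) +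
    (c₃ + ∫ s in (1 / 2 : ℝ)..1, f s / a s) with ht
  have htp : ∀ δ ∈ Ioo (0 : ℝ) 1, IsPrim δ 1 t (fun x => f x / a x) := fun δ hδ =>
    ((IsPrim.primitive (hii δ hδ) right_mem_uIcc).add (IsPrim.const _)).congr_ae
      (Eventually.of_forall fun x _ => add_zero _)
  have h3' : HasWeakDeriv 3 u t := by
    refine h3.congr EventuallyEq.rfl ?_
    filter_upwards [ae_vol01_mem] with x hx
    have := intervalIntegral.integral_add_adjacent_intervals (hii _ hhalf) (hii x hx).symm
    rw [ht, ← this]; ring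
  obtain ⟨c₂, h2⟩ := h3'.exists_lower
  have htc : ∀ δ ∈ Ioo (0 : ℝ) 1, IntervalIntegrable t volume δ 1 := fun δ hδ =>
    (htp δ hδ).continuousOn.intervalIntegrable
  set Q : ℝ → ℝ := fun x => (∫ s in (1 : ℝ)..x, t s) + (c₂ + ∫ s in (1 / 2 : ℝ)..1, t s) with hQ
  have hQp : ∀ δ ∈ Ioo (0 : ℝ) 1, IsPrim δ 1 Q t := fun δ hδ =>
    ((IsPrim.primitive (htc δ hδ) right_mem_uIcc).add (IsPrim.const _)).congr_ae
      (Eventually.of_forall fun x _ => add_zero _)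
  have h2' : HasWeakDeriv 2 u Q := by
    refine h2.congr EventuallyEq.rfl ?_
    filter_upwards [ae_vol01_mem] with x hx
    have := intervalIntegral.integral_add_adjacent_intervals (htc _ hhalf) (htc x hx).symm
    rw [hQ, ← this]; ring
  set D := |c₃ + ∫ s in (1 / 2 : ℝ)..1, f s / a s| + (‖f‖ ^ 2 + 1 / a 1) with hD
  have hD0 : 0 ≤ D := by have := hw.a1_pos; positivity
  have htD : ∀ x ∈ Ioo (0 : ℝ) 1, |t x| ≤ D / √x := by
    intro x hx
    have hsx : 0 < √x := Real.sqrt_pos.2 hx.1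
    have hs1 : √x ≤ 1 := Real.sqrt_le_one.2 hx.2.le
    have e1 : |∫ s in (1 : ℝ)..x, f s / a s| ≤ (‖f‖ ^ 2 + 1 / a 1) / √x := by
      rw [intervalIntegral.integral_symm, abs_neg]
      exact (intervalIntegral.abs_integral_le_integral_abs hx.2.le).trans
        (hw.integral_abs_div_le f hx).2
    have e2 : |c₃ + ∫ s in (1 / 2 : ℝ)..1, f s / a s| ≤
        |c₃ + ∫ s in (1 / 2 : ℝ)..1, f s / a s| / √x := by
      rw [le_div_iff₀ hsx]
      exact mul_le_of_le_one_right (abs_nonneg _) hs1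
    calc |t x| ≤ _ := abs_add_le _ _
      _ ≤ _ := add_le_add e1 e2
      _ = D / √x := by rw [hD]; ring
  have hQD : ∀ x ∈ Ioo (0 : ℝ) 1, |Q x| ≤ |c₂ + ∫ s in (1 / 2 : ℝ)..1, t s| + 2 * D := by
    intro x hx
    obtain ⟨i1, i2⟩ := integral_const_div_sqrt_le hD0 hx
    have e1 : |∫ s in (1 : ℝ)..x, t s| ≤ 2 * D := by
      rw [intervalIntegral.integral_symm, abs_neg]
      refine (intervalIntegral.abs_integral_le_integral_abs hx.2.le).trans (le_trans ?_ i2)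
      refine intervalIntegral.integral_mono_on_of_le_Ioo hx.2.le (htc x hx).abs i1 fun s hs => ?_
      exact htD s ⟨hx.1.trans hs.1, hs.2⟩
    calc |Q x| ≤ _ := abs_add_le _ _
      _ ≤ _ := by rw [add_comm]; gcongr
  refine ⟨t, Q, |c₂ + ∫ s in (1 / 2 : ℝ)..1, t s| + 2 * D, htp, hQp, hu.unique h2',
    fun x hx => (htD x hx).trans ?_, hQD⟩
  gcongr
  have := abs_nonneg (c₂ + ∫ s in (1 / 2 : ℝ)..1, t s)
  linarith

lemma tendsto_prim_zero (r : L2) : Tendsto (prim r) (𝓝[>] 0) (𝓝 0) := by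
  have h := continuousOn_prim r 0 (by simp)
  have h0 : prim r 0 = 0 := by simp [prim]
  rw [ContinuousWithinAt, h0] at h
  refine h.mono_left ?_
  rw [← nhdsWithin_Ioo_eq_nhdsGT (zero_lt_one' ℝ)]
  exact nhdsWithin_mono _ Ioo_subset_Icc_self

lemma IsRegular.C_nonneg {q : L2} {f : L2w a} {t Q : ℝ → ℝ} {C : ℝ}
    (hR : IsRegular a q f t Q C) : 0 ≤ C :=
  (abs_nonneg _).trans (hR.Q_le (1 / 2) (by norm_num))

lemma IsRegular.hasBdryValue {q : L2} {f : L2w a} {t Q : ℝ → ℝ} {C : ℝ}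
    (hR : IsRegular a q f t Q C) : HasBdryValue q 1 (Q 1) := by
  refine HasBdryValue.congr (hasBdryValue_of_continuousWithinAt ?_) hR.ae_eq.symm
  have h := (hR.prim_Q (1 / 2) (by norm_num)).continuousOn 1 (by simp)
  rw [uIcc_of_le (by norm_num)] at h
  refine (h.mono Ioo_subset_Icc_self).mono_of_mem_nhdsWithin ?_
  rw [mem_nhdsWithin]
  exact ⟨Ioi (1 / 2), isOpen_Ioi, by norm_num, fun x hx => ⟨hx.1, hx.2.2⟩⟩

lemma tendsto_mul_sqrt (C : ℝ) : Tendsto (fun x : ℝ => C * √x) (𝓝[>] 0) (𝓝 0) := by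
  have : Tendsto (fun x : ℝ => C * √x) (𝓝 0) (𝓝 (C * √0)) :=
    (continuous_const.mul Real.continuous_sqrt).tendsto 0
  rw [Real.sqrt_zero, mul_zero] at this
  exact this.mono_left nhdsWithin_le_nhds

/-! ### Green's formula and the multiplier identities -/

/-- Green's formula for functions `v = J r` with `v(1) = 0`. -/
lemma IsWeight.green (hw : IsWeight a K) {q : L2} {f : L2w a} {t Q : ℝ → ℝ} {C : ℝ}
    (hR : IsRegular a q f t Q C) (r : L2) (hr : evPrim2 r = 0) :
    inner ℝ f (hw.opJ r) - inner ℝ q r = -(Q 1 * evPrim r) := by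
  rw [hw.inner_eq, inner_L2_eq, ← intervalIntegral.integral_sub
    (hw.intervalIntegrable_mul _ _) (intervalIntegrable_mul_L2 _ _)]
  rw [evPrim2_apply] at hr
  have hC := hR.C_nonneg
  -- With v = Jr, the derivative of u'''v - u''v' is u''''v - u''v''. At 0 the first product is
  -- O(√x), and the second vanishes because u'' is bounded and v'(0) = 0.
  rw [integral_eq_of_isPrim_of_tendsto (G := fun x => t x * prim2 r x - Q x * prim r x)
    ((hw.intervalIntegrable_mul _ _).sub (intervalIntegrable_mul_L2 _ _)), hr, evPrim_apply]
  · ring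
  · intro δ hδ
    refine (((hR.prim_t δ hδ).mul ((isPrim_prim2 r).of_zero_one hδ)).sub
      ((hR.prim_Q δ hδ).mul ((isPrim_prim r).of_zero_one hδ))).congr_ae ?_
    filter_upwards [ae_uIcc_of_ae_vol01 hR.ae_eq hδ, ae_uIcc_of_ae_vol01 (hw.opJ_ae r) hδ]
      with x h1 h2 hx
    rw [h1 hx, h2 hx]; ring
  · have hb : Tendsto (fun x => C * ‖r‖ * √x + C * |prim r x|) (𝓝[>] 0) (𝓝 0) := by
      simpa using (tendsto_mul_sqrt (C * ‖r‖)).add ((tendsto_prim_zero r).abs.const_mul C)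
    refine squeeze_zero_norm' ?_ hb
    filter_upwards [Ioo_mem_nhdsGT (zero_lt_one' ℝ)] with x hx
    have hsx : 0 < √x := Real.sqrt_pos.2 hx.1
    have h1 := hR.t_le x hx
    have h2 := hR.Q_le x hx
    have h3 := abs_prim2_le r ⟨hx.1.le, hx.2.le⟩
    rw [Real.norm_eq_abs]
    calc |t x * prim2 r x - Q x * prim r x| ≤ |t x * prim2 r x| + |Q x * prim r x| := abs_sub _ _
      _ ≤ C / √x * (x * ‖r‖) + C * |prim r x| := by rw [abs_mul, abs_mul]; gcongr
      _ = _ := by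
        have := Real.mul_self_sqrt hx.1.le
        congr 1
        field_simp
        rw [Real.sq_sqrt hx.1.le]

/-- The multiplier identity for `x u'` and `u''''`. -/
lemma IsWeight.inner_opP_eq (hw : IsWeight a K) {q : L2} {f : L2w a} {t Q : ℝ → ℝ} {C : ℝ}
    (hR : IsRegular a q f t Q C) (hq : evPrim q = 0) :
    inner ℝ (hw.opP q) f = 3 / 2 * ‖q‖ ^ 2 - 1 / 2 * Q 1 ^ 2 := by
  suffices h : inner ℝ f (hw.opP q) - 3 / 2 * inner ℝ q q = -(1 / 2 * Q 1 ^ 2) by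
    rw [real_inner_comm, ← real_inner_self_eq_norm_sq]; linarith
  rw [evPrim_apply] at hq
  have hC := hR.C_nonneg
  have i2 := (intervalIntegrable_mul_L2 q q).const_mul (3 / 2)
  rw [hw.inner_eq, inner_L2_eq, ← intervalIntegral.integral_const_mul,
    ← intervalIntegral.integral_sub (hw.intervalIntegrable_mul _ _) i2]
  -- With p = u', the derivative of x p u''' - p u'' - x(u'')²/2 is x p u'''' - (3/2)(u'')². At x =
  -- 1 only the last term survives, as p(1) = 0.
  rw [integral_eq_of_isPrim_of_tendsto
    (G := fun x => x * prim q x * t x - prim q x * Q x - 1 / 2 * (x * (Q x * Q x)))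
    ((hw.intervalIntegrable_mul _ _).sub i2), hq]
  · ring
  · intro δ hδ
    have hp := (isPrim_prim q).of_zero_one hδ
    have hQ := hR.prim_Q δ hδ
    refine ((((IsPrim.id.mul hp).mul (hR.prim_t δ hδ)).sub (hp.mul hQ)).sub
      ((IsPrim.const (1 / 2)).mul (IsPrim.id.mul (hQ.mul hQ)))).congr_ae ?_
    filter_upwards [ae_uIcc_of_ae_vol01 hR.ae_eq hδ, ae_uIcc_of_ae_vol01 (hw.opP_ae q) hδ]
      with x h1 h2 hx
    rw [h1 hx, h2 hx]; ring
  · have hb : Tendsto (fun x => C * ‖q‖ * √x + C * |prim q x| + C ^ 2 * √x) (𝓝[>] 0) (𝓝 0) := by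
      simpa using ((tendsto_mul_sqrt (C * ‖q‖)).add
        ((tendsto_prim_zero q).abs.const_mul C)).add (tendsto_mul_sqrt (C ^ 2))
    refine squeeze_zero_norm' ?_ hb
    filter_upwards [Ioo_mem_nhdsGT (zero_lt_one' ℝ)] with x hx
    have hx0 := hx.1
    have hsx : 0 < √x := Real.sqrt_pos.2 hx.1
    have h1 := hR.t_le x hx
    have h2 := hR.Q_le x hx
    have h3 := abs_prim_le q ⟨hx.1.le, hx.2.le⟩
    have h4 : x ≤ √x := Real.le_sqrt_of_sq_le (by nlinarith [hx.1, hx.2])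
    have h5 : Q x * Q x ≤ C ^ 2 := by
      rw [← abs_mul_abs_self, sq]; gcongr
    have h6 : |x * prim q x * t x| ≤ C * ‖q‖ * √x := by
      rw [abs_mul, abs_mul, abs_of_pos hx.1]
      calc x * |prim q x| * |t x| ≤ x * ‖q‖ * (C / √x) := by gcongr
        _ = _ := by field_simp; rw [Real.sq_sqrt hx.1.le]; ring
    have h7 : |prim q x * Q x| ≤ C * |prim q x| := by
      rw [abs_mul, mul_comm]; gcongr
    have h8 : |1 / 2 * (x * (Q x * Q x))| ≤ C ^ 2 * √x := by
      have h0 := mul_self_nonneg (Q x)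
      rw [abs_of_nonneg (by positivity)]
      calc 1 / 2 * (x * (Q x * Q x)) ≤ 1 * (√x * C ^ 2) := by gcongr; norm_num
        _ = _ := by ring
    rw [Real.norm_eq_abs]
    exact (abs_sub _ _).trans (add_le_add ((abs_sub _ _).trans (add_le_add h6 h7)) h8)

/-- The multiplier identity for `x v'` and `v / a`, as a two-sided bound. -/
lemma IsWeight.inner_opP_opJ (hw : IsWeight a K) (r : L2) (hr : evPrim2 r = 0) :
    (1 - K) * ‖hw.opJ r‖ ^ 2 ≤ -2 * inner ℝ (hw.opP r) (hw.opJ r) ∧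
      -2 * inner ℝ (hw.opP r) (hw.opJ r) ≤ (1 + K) * ‖hw.opJ r‖ ^ 2 := by
  rw [evPrim2_apply] at hr
  have hne : ∀ x ∈ Ioc (0 : ℝ) 1, a x ≠ 0 := fun x hx => (hw.pos x hx).ne'
  set s : ℝ → ℝ := fun x => (1 - x * deriv a x / a x) * (hw.opJ r x * hw.opJ r x / a x) with hs
  have iv := hw.intervalIntegrable_mul (hw.opJ r) (hw.opJ r)
  have ip := (hw.intervalIntegrable_mul (hw.opP r) (hw.opJ r)).const_mul 2
  have hcoef : ∀ x ∈ Ioo (0 : ℝ) 1, |x * deriv a x / a x| ≤ K := by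
    intro x hx
    have ha := hw.pos x ⟨hx.1, hx.2.le⟩
    rw [abs_div, abs_mul, abs_of_pos hx.1, abs_of_pos ha, div_le_iff₀ ha]
    exact hw.bound x hx
  have hvn : ∀ x ∈ Ioo (0 : ℝ) 1, 0 ≤ hw.opJ r x * hw.opJ r x / a x := fun x hx =>
    div_nonneg (mul_self_nonneg _) (hw.pos x ⟨hx.1, hx.2.le⟩).le
  have is : IntervalIntegrable s volume 0 1 := by
    rw [intervalIntegrable_iff_integrableOn_Ioo_of_le zero_le_one] at iv ⊢
    refine Integrable.mono' (iv.const_mul (1 + K)) (AEStronglyMeasurable.mul ?_ iv.1) ?_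
    · have ham : AEMeasurable a (volume.restrict (Ioo 0 1)) := (hw.contDiffOn.continuousOn.mono
        Ioo_subset_Ioc_self).aemeasurable measurableSet_Ioo
      exact (((measurable_id.mul (measurable_deriv a)).aemeasurable.div ham).const_sub
        1).aestronglyMeasurable
    · filter_upwards [ae_restrict_mem measurableSet_Ioo] with x hx
      have h1 := abs_le.1 (hcoef x hx)
      rw [hs, norm_mul, Real.norm_of_nonneg (hvn x hx), Real.norm_eq_abs]
      refine mul_le_mul_of_nonneg_right (abs_le.2 ⟨?_, ?_⟩) (hvn x hx) <;> linarith [hw.K_pos]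
  have key : (∫ x in (0 : ℝ)..1, s x) = -2 * inner ℝ (hw.opP r) (hw.opJ r) := by
    -- With v = Jr, the derivative of x v²/a is (1 - x a'/a) v²/a + 2 x v' v/a. The function
    -- vanishes at 1 because v(1) = 0, and at 0 because it is at most ‖r‖² (x²/a) x.
    have h := integral_eq_of_isPrim_of_tendsto (is.add ip)
      (G := fun x => x / a x * (prim2 r x * prim2 r x)) ?_ ?_
    · rw [hr, mul_zero, mul_zero] at h
      rw [hw.inner_eq]
      have e : ∫ x in (0 : ℝ)..1, (s x + 2 * (hw.opP r x * hw.opJ r x / a x)) = 0 := h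
      rw [intervalIntegral.integral_add is ip, intervalIntegral.integral_const_mul] at e
      linarith
    · intro δ hδ
      have hsub : uIcc δ 1 ⊆ Ioc 0 1 := by
        rw [uIcc_of_le hδ.2.le]; exact fun x hx => ⟨hδ.1.trans_le hx.1, hx.2⟩
      have hxa : IsPrim δ 1 (fun x => x / a x) (fun x => (1 * a x - x * deriv a x) / a x ^ 2) := by
        refine IsPrim.of_contDiffOn (contDiffOn_id.div (hw.contDiffOn.mono hsub)
          fun x hx => hne x (hsub hx)) fun x hx => ?_
        rw [min_eq_left hδ.2.le, max_eq_right hδ.2.le] at hx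
        have hx' : x ∈ Ioo (0 : ℝ) 1 := ⟨hδ.1.trans hx.1, hx.2⟩
        exact (hasDerivAt_id x).fun_div (hw.hasDerivAt hx') (hne x ⟨hx'.1, hx'.2.le⟩)
      have hv := (isPrim_prim2 r).of_zero_one hδ
      refine (hxa.mul (hv.mul hv)).congr_ae ?_
      filter_upwards [ae_uIcc_of_ae_vol01 (hw.opJ_ae r) hδ,
        ae_uIcc_of_ae_vol01 (hw.opP_ae r) hδ] with x h1 h2 hx
      have ha := hne x (hsub hx)
      simp only [hs, h1 hx, h2 hx]
      field_simp
      ring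
    · have hb : Tendsto (fun x : ℝ => ‖r‖ ^ 2 * (1 / a 1) * √x) (𝓝[>] 0) (𝓝 0) :=
        tendsto_mul_sqrt _
      refine squeeze_zero_norm' ?_ hb
      filter_upwards [Ioo_mem_nhdsGT (zero_lt_one' ℝ)] with x hx
      have hx0 := hx.1
      have ha := hw.pos x ⟨hx.1, hx.2.le⟩
      have ha1 := hw.a1_pos
      have h1 := abs_prim2_le r ⟨hx.1.le, hx.2.le⟩
      have h2 := hw.sq_div_le ⟨hx.1, hx.2.le⟩
      have h4 : x ≤ √x := Real.le_sqrt_of_sq_le (by nlinarith [hx.1, hx.2])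
      rw [Real.norm_eq_abs, abs_mul, abs_mul, abs_of_pos (div_pos hx0 ha)]
      calc x / a x * (|prim2 r x| * |prim2 r x|) ≤ x / a x * ((x * ‖r‖) * (x * ‖r‖)) := by gcongr
        _ = ‖r‖ ^ 2 * (x ^ 2 / a x) * x := by ring
        _ ≤ ‖r‖ ^ 2 * (1 / a 1) * √x := by gcongr
  have hn : ‖hw.opJ r‖ ^ 2 = ∫ x in (0 : ℝ)..1, hw.opJ r x * hw.opJ r x / a x := by
    rw [← real_inner_self_eq_norm_sq, hw.inner_eq]
  rw [← key, hn, ← intervalIntegral.integral_const_mul, ← intervalIntegral.integral_const_mul]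
  constructor
  · refine intervalIntegral.integral_mono_on_of_le_Ioo zero_le_one (iv.const_mul _) is
      fun x hx => mul_le_mul_of_nonneg_right ?_ (hvn x hx)
    have := abs_le.1 (hcoef x hx); linarith
  · refine intervalIntegral.integral_mono_on_of_le_Ioo zero_le_one is (iv.const_mul _)
      fun x hx => mul_le_mul_of_nonneg_right ?_ (hvn x hx)
    have := abs_le.1 (hcoef x hx); linarith

/-! ### Duality description of D(A) and the trace at x = 1 -/

/-- The domain of `A` in terms of the second derivative, by duality. -/
lemma IsWeight.inDA_iff (hw : IsWeight a K) {u f : L2w a} {q : L2} (hu : InH2 a u q) :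
    InDA a u f ↔ ∀ r : L2, evPrim r = 0 → evPrim2 r = 0 →
      inner ℝ f (hw.opJ r) = inner ℝ q r := by
  obtain ⟨-, p, hp⟩ := id hu
  constructor
  · rintro ⟨-, g, hg, hf⟩ r h1 h2
    obtain ⟨t, Q, C, hR⟩ := hw.exists_isRegular hp.2.1 hg hf
    have := hw.green hR r h2
    rw [h1] at this
    linarith
  · intro h
    have hl : LocallyIntegrableOn (fun x => f x / a x) (Ioo 0 1) := by
      rw [locallyIntegrableOn_iff isOpen_Ioo.isLocallyClosed]
      intro s hs hc
      obtain ⟨δ, h1, h2, h3⟩ := exists_margin hc hs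
      have hδ : δ ∈ Ioo (0 : ℝ) 1 := ⟨h1, by linarith⟩
      have := (hw.integral_abs_div_le f hδ).1
      rw [intervalIntegrable_iff', uIcc_of_le hδ.2.le] at this
      exact this.mono_set (h3.trans (Icc_subset_Icc_right (by linarith)))
    refine ⟨⟨q, hu⟩, fun x => f x / a x, ⟨hp.1.1, hl, fun φ h1 h2 h3 => ?_⟩, ?_⟩
    · have hφ : IsTest φ := ⟨h1, h2, h3⟩
      have z : ∀ {ψ : ℝ → ℝ}, IsTest ψ → ψ 0 = 0 ∧ ψ 1 = 0 := fun hψ =>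
        ⟨image_eq_zero_of_notMem_tsupport fun hn => lt_irrefl _ (hψ.3 hn).1,
          image_eq_zero_of_notMem_tsupport fun hn => lt_irrefl _ (hψ.3 hn).2⟩
      -- A test function φ equals J φ'' and satisfies the clamped conditions, so φ'' is admissible
      -- in the duality relation, which then reads as the defining identity of the fourth weak
      -- derivative.
      obtain ⟨r, hr, hr1, hr2⟩ := exists_L2_of_contDiff (φ := φ)
        (by exact_mod_cast contDiff_infty.1 h1 2) (z hφ).1 (z hφ.deriv).1
      have key := h r (by rw [evPrim_apply, hr1 1 (by simp), (z hφ.deriv).2])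
        (by rw [evPrim2_apply, hr2 1 (by simp), (z hφ).2])
      rw [hw.inner_eq, inner_L2_eq, intervalIntegral.integral_of_le zero_le_one,
        intervalIntegral.integral_of_le zero_le_one, integral_Ioc_eq_integral_Ioo,
        integral_Ioc_eq_integral_Ioo] at key
      have e1 : ∫ x in Ioo (0 : ℝ) 1, f x * hw.opJ r x / a x =
          ∫ x in Ioo (0 : ℝ) 1, f x / a x * φ x := by
        refine integral_congr_ae ?_
        filter_upwards [hw.opJ_ae r, ae_vol01_mem] with x hx hm
        rw [hx, hr2 x ⟨hm.1.le, hm.2.le⟩]; ring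
      have e2 : ∫ x in Ioo (0 : ℝ) 1, q x * r x =
          ∫ x in Ioo (0 : ℝ) 1, q x * iteratedDeriv 2 φ x :=
        integral_congr_ae (hr.mono fun x hx => by simp only [hx])
      have hφ2 := hφ.iteratedDeriv 2
      have e3 := hp.2.1.2.2 _ hφ2.1 hφ2.2 hφ2.3
      have e4 : iteratedDeriv 2 (iteratedDeriv 2 φ) = iteratedDeriv 4 φ := by
        simp only [iteratedDeriv_eq_iterate, ← Function.iterate_add_apply]
      rw [e4] at e3
      rw [e3, ← e1, key, e2]
      norm_num
    · filter_upwards [ae_vol01_mem] with x hx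
      exact mul_div_cancel₀ _ (hw.pos x ⟨hx.1, hx.2.le⟩).ne'

/-- The boundary value of `u''` at `1` for `u ∈ D(A)`. -/
lemma IsWeight.inDA_trace (hw : IsWeight a K) {u f : L2w a} {q : L2} (hu : InH2 a u q)
    (hf : InDA a u f) : ∃ b : ℝ, HasBdryValue q 1 b ∧
      (∀ r : L2, evPrim2 r = 0 → inner ℝ f (hw.opJ r) - inner ℝ q r = -(b * evPrim r)) ∧
      inner ℝ (hw.opP q) f = 3 / 2 * ‖q‖ ^ 2 - 1 / 2 * b ^ 2 := by
  obtain ⟨-, p, hp⟩ := id hu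
  obtain ⟨-, g, hg, hf⟩ := hf
  obtain ⟨t, Q, C, hR⟩ := hw.exists_isRegular hp.2.1 hg hf
  exact ⟨Q 1, hR.hasBdryValue, hw.green hR, hw.inner_opP_eq hR (hw.inH2_iff.1 hu).2.1⟩

end

section

variable {a : ℝ → ℝ} {K : ℝ}

/-! ### Linearity and closedness of the operators -/

lemma IsWeight.inH2_smul_sub (hw : IsWeight a K) {u u' : L2w a} {q q' : L2} (h : InH2 a u q)
    (h' : InH2 a u' q') (k : ℝ) : InH2 a (k • (u - u')) (k • (q - q')) := by
  rw [hw.inH2_iff] at *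
  obtain ⟨rfl, h1, h2⟩ := h
  obtain ⟨rfl, h1', h2'⟩ := h'
  refine ⟨by rw [map_smul, map_sub], ?_, ?_⟩
  · rw [map_smul, map_sub, h1, h1', sub_zero, smul_zero]
  · rw [map_smul, map_sub, h2, h2', sub_zero, smul_zero]

lemma IsWeight.inDA_smul_sub (hw : IsWeight a K) {u u' f f' : L2w a} {q q' : L2}
    (h : InH2 a u q) (h' : InH2 a u' q') (hf : InDA a u f) (hf' : InDA a u' f') (k : ℝ) :
    InDA a (k • (u - u')) (k • (f - f')) := by
  rw [hw.inDA_iff (hw.inH2_smul_sub h h' k)]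
  intro r h1 h2
  rw [real_inner_smul_left, real_inner_smul_left, inner_sub_left, inner_sub_left,
    (hw.inDA_iff h).1 hf r h1 h2, (hw.inDA_iff h').1 hf' r h1 h2]

/-- J and the two evaluations at 1 are bounded linear maps, so they commute with the integral. -/
lemma IsWeight.inH2_integral (hw : IsWeight a K) {u : ℝ → L2w a} {q : ℝ → L2} {c d : ℝ}
    (hcd : c ≤ d) (hq : ContinuousOn q (Icc c d)) (h : ∀ s ∈ Icc c d, InH2 a (u s) (q s)) :
    InH2 a (∫ s in c..d, u s) (∫ s in c..d, q s) := by
  have hi : IntervalIntegrable q volume c d := hq.intervalIntegrable_of_Icc hcd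
  have hs : ∀ s ∈ uIcc c d, InH2 a (u s) (q s) := by rwa [uIcc_of_le hcd]
  rw [hw.inH2_iff]
  refine ⟨?_, ?_, ?_⟩
  · rw [← hw.opJ.intervalIntegral_comp_comm hi]
    exact intervalIntegral.integral_congr fun s hs' => (hw.inH2_iff.1 (hs s hs')).1
  · rw [← evPrim.intervalIntegral_comp_comm hi,
      intervalIntegral.integral_congr (g := fun _ => 0) fun s hs' =>
        (hw.inH2_iff.1 (hs s hs')).2.1, intervalIntegral.integral_zero]
  · rw [← evPrim2.intervalIntegral_comp_comm hi,
      intervalIntegral.integral_congr (g := fun _ => 0) fun s hs' =>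
        (hw.inH2_iff.1 (hs s hs')).2.2, intervalIntegral.integral_zero]

/-- In the duality description each relation is linear and continuous in (q, f), so it survives
integration; no estimate of fourth derivatives is needed. -/
lemma IsWeight.inDA_integral (hw : IsWeight a K) {u f : ℝ → L2w a} {q : ℝ → L2} {c d : ℝ}
    (hcd : c ≤ d) (hq : ContinuousOn q (Icc c d)) (hf : ContinuousOn f (Icc c d))
    (h : ∀ s ∈ Icc c d, InH2 a (u s) (q s)) (h' : ∀ s ∈ Icc c d, InDA a (u s) (f s)) :
    InDA a (∫ s in c..d, u s) (∫ s in c..d, f s) := by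
  rw [hw.inDA_iff (hw.inH2_integral hcd hq h)]
  intro r h1 h2
  rw [real_inner_comm, real_inner_comm r]
  have e1 := (innerSL ℝ (hw.opJ r)).intervalIntegral_comp_comm
    (hf.intervalIntegrable_of_Icc (μ := volume) hcd)
  have e2 := (innerSL ℝ r).intervalIntegral_comp_comm
    (hq.intervalIntegrable_of_Icc (μ := volume) hcd)
  simp only [innerSL_apply_apply] at e1 e2
  rw [← e1, ← e2]
  refine intervalIntegral.integral_congr fun s hs => ?_
  rw [uIcc_of_le hcd] at hs
  have := (hw.inDA_iff (h s hs)).1 (h' s hs) r h1 h2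
  rw [real_inner_comm, real_inner_comm r] at this
  exact this

lemma integral_eq_sub_of_hasDerivWithinAt {E : Type*} [NormedAddCommGroup E] [NormedSpace ℝ E]
    [CompleteSpace E] {G G' : ℝ → E} (h : ∀ t, 0 ≤ t → HasDerivWithinAt G (G' t) (Ici 0) t)
    (hc : ContinuousOn G' (Ici 0)) {T : ℝ} (hT : 0 ≤ T) : ∫ t in (0 : ℝ)..T, G' t = G T - G 0 := by
  have hsub : Icc 0 T ⊆ Ici (0 : ℝ) := Icc_subset_Ici_self
  refine intervalIntegral.integral_eq_sub_of_hasDeriv_right ?_ (fun t ht => ?_)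
    ((hc.mono hsub).intervalIntegrable_of_Icc hT)
  · rw [uIcc_of_le hT]
    exact fun t ht => ((h t ht.1).continuousWithinAt).mono hsub
  · rw [min_eq_left hT] at ht
    exact (h t ht.1.le).mono fun s hs => ht.1.le.trans (le_of_lt hs)

/-! ### Estimates for classical solutions -/

/-- The functions `y`, `v = y_t`, `f = A y`, `q = y_xx` and `r = y_txx` of a classical solution. -/
structure IsClassicalData (a : ℝ → ℝ) (y v f : ℝ → L2w a) (q r : ℝ → L2) : Prop where
  inH2 : ∀ t, 0 ≤ t → InH2 a (y t) (q t)
  inH2_v : ∀ t, 0 ≤ t → InH2 a (v t) (r t)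
  inDA : ∀ t, 0 ≤ t → InDA a (y t) (f t)
  deriv_y : ∀ t, 0 ≤ t → HasDerivWithinAt y (v t) (Ici 0) t
  deriv_v : ∀ t, 0 ≤ t → HasDerivWithinAt v (-f t) (Ici 0) t
  deriv_q : ∀ t, 0 ≤ t → HasDerivWithinAt q (r t) (Ici 0) t
  cont_f : ContinuousOn f (Ici 0)
  cont_r : ContinuousOn r (Ici 0)

namespace IsClassicalData

variable {y v f y' v' f' : ℝ → L2w a} {q r q' r' : ℝ → L2}

lemma sub (hw : IsWeight a K) (h : IsClassicalData a y v f q r)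
    (h' : IsClassicalData a y' v' f' q' r') :
    IsClassicalData a (y - y') (v - v') (f - f') (q - q') (r - r') where
  inH2 t ht := by simpa using hw.inH2_smul_sub (h.inH2 t ht) (h'.inH2 t ht) 1
  inH2_v t ht := by simpa using hw.inH2_smul_sub (h.inH2_v t ht) (h'.inH2_v t ht) 1
  inDA t ht := by
    simpa using hw.inDA_smul_sub (h.inH2 t ht) (h'.inH2 t ht) (h.inDA t ht) (h'.inDA t ht) 1
  deriv_y t ht := (h.deriv_y t ht).sub (h'.deriv_y t ht)
  deriv_v t ht := ((h.deriv_v t ht).sub (h'.deriv_v t ht)).congr_deriv (by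
    rw [Pi.sub_apply]; abel)
  deriv_q t ht := (h.deriv_q t ht).sub (h'.deriv_q t ht)
  cont_f := h.cont_f.sub h'.cont_f
  cont_r := h.cont_r.sub h'.cont_r

lemma cont_q (h : IsClassicalData a y v f q r) : ContinuousOn q (Ici 0) := fun t ht =>
  (h.deriv_q t ht).continuousWithinAt

lemma cont_v (h : IsClassicalData a y v f q r) : ContinuousOn v (Ici 0) := fun t ht =>
  (h.deriv_v t ht).continuousWithinAt

/-- Twice the energy is constant. -/
lemma energy_eq (hw : IsWeight a K) (h : IsClassicalData a y v f q r) {t : ℝ} (ht : 0 ≤ t) :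
    ‖v t‖ ^ 2 + ‖q t‖ ^ 2 = ‖v 0‖ ^ 2 + ‖q 0‖ ^ 2 := by
  have hd : ∀ t, 0 ≤ t → HasDerivWithinAt (fun t => inner ℝ (v t) (v t) + inner ℝ (q t) (q t))
      ((fun _ => (0 : ℝ)) t) (Ici 0) t := by
    intro t ht
    refine (((h.deriv_v t ht).inner ℝ (h.deriv_v t ht)).fun_add
      ((h.deriv_q t ht).inner ℝ (h.deriv_q t ht))).congr_deriv ?_
    obtain ⟨e, h1, h2⟩ := hw.inH2_iff.1 (h.inH2_v t ht)
    have key := (hw.inDA_iff (h.inH2 t ht)).1 (h.inDA t ht) (r t) h1 h2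
    rw [← e] at key
    rw [inner_neg_left, inner_neg_right, real_inner_comm, key, real_inner_comm (q t) (r t)]
    ring
  have := integral_eq_sub_of_hasDerivWithinAt hd continuousOn_const ht
  simp only [intervalIntegral.integral_zero, real_inner_self_eq_norm_sq] at this
  linarith

/-- Here y itself is the multiplier: the duality relation is applied with q as the second
derivative. It allows kinetic and elastic energy to be exchanged up to terms at the initial and
final times. -/
lemma hasDeriv_inner_y (hw : IsWeight a K) (h : IsClassicalData a y v f q r) {t : ℝ}
    (ht : 0 ≤ t) :
    HasDerivWithinAt (fun t => inner ℝ (y t) (v t)) (‖v t‖ ^ 2 - ‖q t‖ ^ 2) (Ici 0) t := by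
  refine ((h.deriv_y t ht).inner ℝ (h.deriv_v t ht)).congr_deriv ?_
  obtain ⟨e, h1, h2⟩ := hw.inH2_iff.1 (h.inH2 t ht)
  have key := (hw.inDA_iff (h.inH2 t ht)).1 (h.inDA t ht) (q t) h1 h2
  rw [← e] at key
  rw [inner_neg_right, real_inner_comm, key, real_inner_self_eq_norm_sq,
    real_inner_self_eq_norm_sq]
  ring

lemma hasDeriv_inner_opP (hw : IsWeight a K) (h : IsClassicalData a y v f q r) {t : ℝ}
    (ht : 0 ≤ t) :
    HasDerivWithinAt (fun t => inner ℝ (hw.opP (q t)) (v t))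
      (inner ℝ (hw.opP (r t)) (v t) - inner ℝ (hw.opP (q t)) (f t)) (Ici 0) t := by
  have hP : HasDerivWithinAt (fun t => hw.opP (q t)) (hw.opP (r t)) (Ici 0) t :=
    hw.opP.hasFDerivAt.comp_hasDerivWithinAt t (h.deriv_q t ht)
  refine (hP.inner ℝ (h.deriv_v t ht)).congr_deriv ?_
  rw [inner_neg_right]
  ring

lemma continuousOn_deriv_inner_opP (hw : IsWeight a K) (h : IsClassicalData a y v f q r) :
    ContinuousOn (fun t => inner ℝ (hw.opP (r t)) (v t) - inner ℝ (hw.opP (q t)) (f t))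
      (Ici 0) :=
  ((hw.opP.continuous.comp_continuousOn h.cont_r).inner h.cont_v).sub
    ((hw.opP.continuous.comp_continuousOn h.cont_q).inner h.cont_f)

/-- Green's formula against a fixed element vanishing at 1 with slope 1 there writes the trace as a
continuous linear functional of (q, f). -/
lemma continuousOn_trace (hw : IsWeight a K) (h : IsClassicalData a y v f q r) {T : ℝ}
    {b : ℝ → ℝ} (hb : ∀ t ∈ Icc 0 T, HasBdryValue (q t) 1 (b t)) : ContinuousOn b (Icc 0 T) := by
  obtain ⟨ρ, h1, h2⟩ := exists_evPrim_eq_one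
  have hsub : Icc 0 T ⊆ Ici (0 : ℝ) := Icc_subset_Ici_self
  have hc : ContinuousOn (fun t => inner ℝ (q t) ρ - inner ℝ (f t) (hw.opJ ρ)) (Icc 0 T) :=
    (((h.cont_q).mono hsub).inner continuousOn_const).sub
      ((h.cont_f.mono hsub).inner continuousOn_const)
  refine hc.congr fun t ht => ?_
  obtain ⟨b', hb', hg, -⟩ := hw.inDA_trace (h.inH2 t ht.1) (h.inDA t ht.1)
  have := hg ρ h2
  rw [(hb t ht).unique (by simp) hb']
  rw [h1, mul_one] at this
  linarith

lemma trace_sq_eq (hw : IsWeight a K) (h : IsClassicalData a y v f q r) {t b : ℝ} (ht : 0 ≤ t)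
    (hb : HasBdryValue (q t) 1 b) : b ^ 2 = 3 * ‖q t‖ ^ 2 - 2 * inner ℝ (hw.opP (q t)) (f t) := by
  obtain ⟨b', hb', -, hP⟩ := hw.inDA_trace (h.inH2 t ht) (h.inDA t ht)
  rw [hb.unique (by simp) hb']
  linarith

lemma inner_opP_v (hw : IsWeight a K) (h : IsClassicalData a y v f q r) {t : ℝ} (ht : 0 ≤ t) :
    (1 - K) * ‖v t‖ ^ 2 ≤ -2 * inner ℝ (hw.opP (r t)) (v t) ∧
      -2 * inner ℝ (hw.opP (r t)) (v t) ≤ (1 + K) * ‖v t‖ ^ 2 := by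
  obtain ⟨e, -, h2⟩ := hw.inH2_iff.1 (h.inH2_v t ht)
  rw [e]
  exact hw.inner_opP_opJ (r t) h2

/-- Stated for a general L because it serves both multipliers, J (giving y) and P (giving x y_x).
Conservation of energy makes the bound independent of t. -/
lemma abs_inner_le (hw : IsWeight a K) (h : IsClassicalData a y v f q r) {L : L2 →L[ℝ] L2w a}
    (hL : ∀ q, ‖L q‖ ≤ 1 / √(a 1) * ‖q‖) {t : ℝ} (ht : 0 ≤ t) :
    |inner ℝ (L (q t)) (v t)| ≤ 1 / √(a 1) * ((‖v 0‖ ^ 2 + ‖q 0‖ ^ 2) / 2) := by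
  have hs : 0 < √(a 1) := Real.sqrt_pos.2 hw.a1_pos
  calc |inner ℝ (L (q t)) (v t)| ≤ ‖L (q t)‖ * ‖v t‖ := abs_real_inner_le_norm _ _
    _ ≤ 1 / √(a 1) * ‖q t‖ * ‖v t‖ := by gcongr; exact hL _
    _ = 1 / √(a 1) * (‖q t‖ * ‖v t‖) := by ring
    _ ≤ 1 / √(a 1) * ((‖v 0‖ ^ 2 + ‖q 0‖ ^ 2) / 2) := by
      rw [← h.energy_eq hw ht]
      gcongr
      nlinarith [sq_nonneg (‖q t‖ - ‖v t‖)]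

/-- The direct inequality: the trace is controlled by the energy. -/
lemma integral_trace_sq_le (hw : IsWeight a K) (h : IsClassicalData a y v f q r) {T : ℝ}
    (hT : 0 ≤ T) {b : ℝ → ℝ} (hb : ∀ t ∈ Icc 0 T, HasBdryValue (q t) 1 (b t)) :
    ∫ t in (0 : ℝ)..T, b t ^ 2 ≤ (2 / √(a 1) + 3 * T) * (‖v 0‖ ^ 2 + ‖q 0‖ ^ 2) := by
  have hsub : Icc 0 T ⊆ Ici (0 : ℝ) := Icc_subset_Ici_self
  have hM := integral_eq_sub_of_hasDerivWithinAt (fun t ht => h.hasDeriv_inner_opP hw ht)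
    (h.continuousOn_deriv_inner_opP hw) hT
  have hMi := ((h.continuousOn_deriv_inner_opP hw).mono hsub).intervalIntegrable_of_Icc
    (μ := volume) hT
  have hbi := ((h.continuousOn_trace hw hb).pow 2).intervalIntegrable_of_Icc (μ := volume) hT
  -- Pointwise b² = 2M' + 3‖q‖² - 2⟨Pr, v⟩ with M = ⟨Pq, v⟩, and the last term is at most (1+K)‖v‖²
  -- ≤ 3‖v‖².
  have hle : ∫ t in (0 : ℝ)..T, b t ^ 2 ≤ ∫ t in (0 : ℝ)..T,
      (2 * (inner ℝ (hw.opP (r t)) (v t) - inner ℝ (hw.opP (q t)) (f t)) +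
        3 * (‖v 0‖ ^ 2 + ‖q 0‖ ^ 2)) := by
    refine intervalIntegral.integral_mono_on hT hbi
      ((hMi.const_mul 2).add intervalIntegrable_const) fun t ht => ?_
    have e1 := h.trace_sq_eq hw ht.1 (hb t ht)
    have e2 := (h.inner_opP_v hw ht.1).2
    rw [← h.energy_eq hw ht.1, e1]
    nlinarith [mul_le_mul_of_nonneg_right hw.K_lt.le (sq_nonneg ‖v t‖)]
  rw [intervalIntegral.integral_add (hMi.const_mul 2) intervalIntegrable_const,
    intervalIntegral.integral_const_mul, hM, intervalIntegral.integral_const, sub_zero,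
    smul_eq_mul] at hle
  have m1 := abs_le.1 (h.abs_inner_le hw hw.norm_opP_le hT)
  have m2 := abs_le.1 (h.abs_inner_le hw hw.norm_opP_le le_rfl)
  refine hle.trans ?_
  have e : (2 / √(a 1) + 3 * T) * (‖v 0‖ ^ 2 + ‖q 0‖ ^ 2) =
      4 * (1 / √(a 1) * ((‖v 0‖ ^ 2 + ‖q 0‖ ^ 2) / 2)) +
        T * (3 * (‖v 0‖ ^ 2 + ‖q 0‖ ^ 2)) := by ring
  rw [e]
  linarith [m1.2, m2.1]

/-- The observability inequality for classical solutions. -/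
lemma le_integral_trace_sq (hw : IsWeight a K) (h : IsClassicalData a y v f q r) {T : ℝ}
    (hT : 0 ≤ T) {b : ℝ → ℝ} (hb : ∀ t ∈ Icc 0 T, HasBdryValue (q t) 1 (b t)) {m : ℝ}
    (hm1 : 1 ≤ m) (hm2 : 4 / a 1 ≤ m) :
    (T * (2 - K) - 4 * m) * ((‖v 0‖ ^ 2 + ‖q 0‖ ^ 2) / 2) ≤ ∫ t in (0 : ℝ)..T, b t ^ 2 := by
  have hsub : Icc 0 T ⊆ Ici (0 : ℝ) := Icc_subset_Ici_self
  have hK0 := hw.K_pos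
  have hK2 := hw.K_lt
  have hs : 0 < √(a 1) := Real.sqrt_pos.2 hw.a1_pos
  -- Squared, this reads 1/a(1) ≤ m²/4, which follows from 1/a(1) ≤ m/4 and m ≥ 1.
  have hsm : 1 / √(a 1) ≤ m / 2 := by
    refine abs_le_of_sq_le_sq' ?_ (by linarith) |>.2
    rw [div_pow, Real.sq_sqrt hw.a1_pos.le, one_pow]
    have : 4 / a 1 = 4 * (1 / a 1) := by ring
    nlinarith
  have hM := integral_eq_sub_of_hasDerivWithinAt (fun t ht => h.hasDeriv_inner_opP hw ht)
    (h.continuousOn_deriv_inner_opP hw) hT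
  have hMi := ((h.continuousOn_deriv_inner_opP hw).mono hsub).intervalIntegrable_of_Icc
    (μ := volume) hT
  have hNc : ContinuousOn (fun t => ‖v t‖ ^ 2 - ‖q t‖ ^ 2) (Ici 0) :=
    (h.cont_v.norm.pow 2).sub (h.cont_q.norm.pow 2)
  have hN := integral_eq_sub_of_hasDerivWithinAt (fun t ht => h.hasDeriv_inner_y hw ht) hNc hT
  have hNi := (hNc.mono hsub).intervalIntegrable_of_Icc (μ := volume) hT
  have hbi := ((h.continuousOn_trace hw hb).pow 2).intervalIntegrable_of_Icc (μ := volume) hT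
  -- Pointwise b² ≥ 2M' + (1-K)‖v‖² + 3‖q‖², with M = ⟨Pq, v⟩. The coefficients are chosen so that
  -- the energy terms on the left add up to (1-K)‖v‖² + ‖q‖², leaving 2‖q‖² to spare.
  have hle : ∫ t in (0 : ℝ)..T,
      (2 * (inner ℝ (hw.opP (r t)) (v t) - inner ℝ (hw.opP (q t)) (f t)) -
        K / 2 * (‖v t‖ ^ 2 - ‖q t‖ ^ 2) + (1 - K / 2) * (‖v 0‖ ^ 2 + ‖q 0‖ ^ 2)) ≤
      ∫ t in (0 : ℝ)..T, b t ^ 2 := by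
    refine intervalIntegral.integral_mono_on hT
      (((hMi.const_mul 2).sub (hNi.const_mul _)).add intervalIntegrable_const) hbi fun t ht => ?_
    have e1 := h.trace_sq_eq hw ht.1 (hb t ht)
    have e2 := (h.inner_opP_v hw ht.1).1
    rw [← h.energy_eq hw ht.1, e1]
    nlinarith [sq_nonneg ‖q t‖]
  rw [intervalIntegral.integral_add ((hMi.const_mul 2).sub (hNi.const_mul _))
      intervalIntegrable_const,
    intervalIntegral.integral_sub (hMi.const_mul 2) (hNi.const_mul _),
    intervalIntegral.integral_const_mul, intervalIntegral.integral_const_mul, hM, hN,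
    intervalIntegral.integral_const, sub_zero, smul_eq_mul] at hle
  set E := (‖v 0‖ ^ 2 + ‖q 0‖ ^ 2) / 2 with hE
  have hE0 : 0 ≤ E := by positivity
  have hy : ∀ {t : ℝ}, 0 ≤ t → |inner ℝ (y t) (v t)| ≤ 1 / √(a 1) * E := by
    intro t ht
    rw [(hw.inH2_iff.1 (h.inH2 t ht)).1]
    exact h.abs_inner_le hw hw.norm_opJ_le ht
  have hB : 1 / √(a 1) * E ≤ m / 2 * E := by gcongr
  have m1 := abs_le.1 (h.abs_inner_le hw hw.norm_opP_le hT)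
  have m2 := abs_le.1 (h.abs_inner_le hw hw.norm_opP_le le_rfl)
  rw [← hE] at m1 m2
  have n1 := abs_le.1 (hy hT)
  have n2 := abs_le.1 (hy le_rfl)
  -- As K/2 ≤ 1, this term costs at most mE. The two values of 2⟨x y_x, y_t⟩ cost at most 2mE, so
  -- the total stays within 4mE.
  have hNN : K / 2 * (inner ℝ (y T) (v T) - inner ℝ (y 0) (v 0)) ≤ 2 * (m / 2 * E) := by
    have hle2 : inner ℝ (y T) (v T) - inner ℝ (y 0) (v 0) ≤ 2 * (m / 2 * E) := by
      linarith [n1.2, n2.1]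
    have hmE : 0 ≤ m / 2 * E := by positivity
    nlinarith
  have hEE : ‖v 0‖ ^ 2 + ‖q 0‖ ^ 2 = 2 * E := by rw [hE]; ring
  rw [hEE] at hle
  refine le_trans ?_ hle
  have hmE : 0 ≤ m * E := by positivity
  linarith [m1.1, m2.2]

end IsClassicalData

end

/-! ### Averages in time -/

/-- The average of `g` over `[t, t + h]`. -/
noncomputable def avg {E : Type*} [NormedAddCommGroup E] [NormedSpace ℝ E] (h : ℝ) (g : ℝ → E)
    (t : ℝ) : E :=
  h⁻¹ • ∫ s in t..(t + h), g s

lemma avg_eq {E : Type*} [NormedAddCommGroup E] [NormedSpace ℝ E] {h : ℝ} (hh : 0 ≤ h)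
    {g : ℝ → E} (hg : ContinuousOn g (Ici 0)) {t : ℝ} (ht : 0 ≤ t) :
    avg h g t = h⁻¹ • ((∫ s in (0 : ℝ)..(t + h), g s) - ∫ s in (0 : ℝ)..t, g s) := by
  have hi : ∀ {d : ℝ}, 0 ≤ d → IntervalIntegrable g volume 0 d := fun hd =>
    (hg.mono Icc_subset_Ici_self).intervalIntegrable_of_Icc hd
  rw [avg, intervalIntegral.integral_interval_sub_left (hi (by linarith)) (hi ht)]

lemma hasDerivWithinAt_avg {E : Type*} [NormedAddCommGroup E] [NormedSpace ℝ E]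
    [CompleteSpace E] {h : ℝ} (hh : 0 ≤ h) {g : ℝ → E} (hg : ContinuousOn g (Ici 0)) {t : ℝ}
    (ht : 0 ≤ t) : HasDerivWithinAt (avg h g) (h⁻¹ • (g (t + h) - g t)) (Ici 0) t := by
  -- Values at negative times are arbitrary; freezing g at time 0 gives a function continuous on ℝ,
  -- to which the two-sided fundamental theorem applies.
  set g' : ℝ → E := fun t => g (max t 0) with hg'
  have hc : Continuous g' := hg.comp_continuous (continuous_id.max continuous_const)
    fun t => mem_Ici.2 (le_max_right _ _)
  have hgg : ∀ {d : ℝ}, 0 ≤ d → ∫ s in (0 : ℝ)..d, g s = ∫ s in (0 : ℝ)..d, g' s := fun hd =>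
    intervalIntegral.integral_congr fun s hs => by
      rw [uIcc_of_le hd] at hs
      simp only [hg', max_eq_left hs.1]
  have hd : ∀ x, HasDerivAt (fun x => ∫ s in (0 : ℝ)..x, g' s) (g' x) x := fun x =>
    intervalIntegral.integral_hasDerivAt_right (hc.intervalIntegrable _ _)
      hc.stronglyMeasurable.stronglyMeasurableAtFilter hc.continuousAt
  have hfull : HasDerivAt (fun t => h⁻¹ • ((∫ s in (0 : ℝ)..(t + h), g' s) -
      ∫ s in (0 : ℝ)..t, g' s)) (h⁻¹ • (g' (t + h) - g' t)) t :=
    (((hd (t + h)).comp_add_const t h).fun_sub (hd t)).const_smul _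
  have e1 : g' (t + h) = g (t + h) := by simp only [hg', max_eq_left (add_nonneg ht hh)]
  have e2 : g' t = g t := by simp only [hg', max_eq_left ht]
  rw [e1, e2] at hfull
  have heq : ∀ s, 0 ≤ s → avg h g s = h⁻¹ • ((∫ τ in (0 : ℝ)..(s + h), g' τ) -
      ∫ τ in (0 : ℝ)..s, g' τ) := fun s hs => by
    rw [avg_eq hh hg hs, hgg (add_nonneg hs hh), hgg hs]
  exact hfull.hasDerivWithinAt.congr (fun s hs => heq s hs) (heq t ht)

lemma tendsto_avg_zero {E : Type*} [NormedAddCommGroup E] [NormedSpace ℝ E]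
    [CompleteSpace E] {g : ℝ → E} (hg : ContinuousOn g (Ici 0)) :
    Tendsto (fun h => avg h g 0) (𝓝[>] 0) (𝓝 (g 0)) := by
  set g' : ℝ → E := fun t => g (max t 0) with hg'
  have hc : Continuous g' := hg.comp_continuous (continuous_id.max continuous_const)
    fun t => mem_Ici.2 (le_max_right _ _)
  have hd : HasDerivAt (fun x => ∫ s in (0 : ℝ)..x, g' s) (g' 0) 0 :=
    intervalIntegral.integral_hasDerivAt_right (hc.intervalIntegrable _ _)
      hc.stronglyMeasurable.stronglyMeasurableAtFilter hc.continuousAt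
  have ht := hd.tendsto_slope_zero_right
  have e : g' 0 = g 0 := by simp [hg']
  rw [e] at ht
  refine ht.congr' ?_
  filter_upwards [self_mem_nhdsWithin] with x hx
  rw [avg, intervalIntegral.integral_same, sub_zero]
  congr 1
  refine intervalIntegral.integral_congr fun s hs => ?_
  rw [zero_add, uIcc_of_le (le_of_lt hx)] at hs
  simp only [hg', max_eq_left hs.1]

section

variable {a : ℝ → ℝ} {K : ℝ}

namespace IsClassicalData

variable {y v f : ℝ → L2w a} {q r : ℝ → L2}

/-- The mild solution with the given classical data. -/
noncomputable def toMild (hw : IsWeight a K) (h : IsClassicalData a y v f q r) :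
    MildSolution a where
  y := y
  yt := v
  yxx := q
  inH2 := h.inH2
  continuousOn_yxx := h.cont_q
  hasDeriv_y := h.deriv_y
  continuousOn_yt := h.cont_v
  mild t ht := by
    have hsub : Icc 0 t ⊆ Ici (0 : ℝ) := Icc_subset_Ici_self
    have e := integral_eq_sub_of_hasDerivWithinAt h.deriv_v h.cont_f.neg ht
    have e' : ∫ s in (0 : ℝ)..t, f s = v 0 - v t := by
      have := intervalIntegral.integral_neg (f := f) (a := 0) (b := t) (μ := volume)
      rw [this] at e
      rw [← neg_sub, ← e, neg_neg]
    rw [← e']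
    exact hw.inDA_integral ht (h.cont_q.mono hsub) (h.cont_f.mono hsub)
      (fun s hs => h.inH2 s hs.1) fun s hs => h.inDA s hs.1

lemma isClassical_toMild (hw : IsWeight a K) (h : IsClassicalData a y v f q r) :
    (h.toMild hw).IsClassical :=
  ⟨⟨f, h.cont_f, fun t ht => ⟨h.inDA t ht, h.deriv_v t ht⟩⟩,
    ⟨r, h.cont_r, fun t ht => ⟨h.inH2_v t ht, h.deriv_q t ht⟩⟩⟩

end IsClassicalData

lemma MildSolution.IsClassical.exists_data {Y : MildSolution a} (h : Y.IsClassical) :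
    ∃ f r, IsClassicalData a Y.y Y.yt f Y.yxx r := by
  obtain ⟨⟨f, hf, h1⟩, r, hr, h2⟩ := h
  exact ⟨f, r, Y.inH2, fun t ht => (h2 t ht).1, fun t ht => (h1 t ht).1, Y.hasDeriv_y,
    fun t ht => (h1 t ht).2, fun t ht => (h2 t ht).2, hf, hr⟩

/-- Averaging a mild solution in time gives a classical solution. -/
lemma MildSolution.isClassicalData_avg (hw : IsWeight a K) (Y : MildSolution a) {h : ℝ}
    (hh : 0 ≤ h) :
    IsClassicalData a (avg h Y.y) (fun t => h⁻¹ • (Y.y (t + h) - Y.y t))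
      (fun t => h⁻¹ • (Y.yt t - Y.yt (t + h))) (avg h Y.yxx)
      (fun t => h⁻¹ • (Y.yxx (t + h) - Y.yxx t)) := by
  have hy : ContinuousOn Y.y (Ici 0) := fun t ht => (Y.hasDeriv_y t ht).continuousWithinAt
  have hm : MapsTo (fun t : ℝ => t + h) (Ici 0) (Ici 0) := fun t ht => add_nonneg ht hh
  have hshift : ContinuousOn (fun t : ℝ => t + h) (Ici 0) := by fun_prop
  have hint : ∀ t, 0 ≤ t → InH2 a (∫ s in (0 : ℝ)..t, Y.y s) (∫ s in (0 : ℝ)..t, Y.yxx s) :=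
    fun t ht => hw.inH2_integral ht (Y.continuousOn_yxx.mono Icc_subset_Ici_self)
      fun s hs => Y.inH2 s hs.1
  refine ⟨fun t ht => ?_, fun t ht => ?_, fun t ht => ?_, fun t ht => hasDerivWithinAt_avg hh hy ht,
    fun t ht => ?_, fun t ht => hasDerivWithinAt_avg hh Y.continuousOn_yxx ht, ?_, ?_⟩
  · rw [avg_eq hh hy ht, avg_eq hh Y.continuousOn_yxx ht]
    exact hw.inH2_smul_sub (hint _ (hm ht)) (hint _ ht) _
  · exact hw.inH2_smul_sub (Y.inH2 _ (hm ht)) (Y.inH2 _ ht) _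
  · rw [avg_eq hh hy ht]
    -- The mild identity at t + h minus the one at t: the initial velocity cancels, and A applied to
    -- the average is a difference quotient of y_t.
    have := hw.inDA_smul_sub (hint _ (hm ht)) (hint _ ht) (Y.mild _ (hm ht)) (Y.mild _ ht) h⁻¹
    rwa [sub_sub_sub_cancel_left] at this
  · have h1 : HasDerivWithinAt (fun t => Y.y (t + h)) (Y.yt (t + h)) (Ici 0) t := by
      have := (Y.hasDeriv_y (t + h) (hm ht)).scomp t
        ((hasDerivWithinAt_id t (Ici 0)).add_const h) hm
      simpa [Function.comp_def] using this
    refine ((h1.fun_sub (Y.hasDeriv_y t ht)).const_smul h⁻¹).congr_deriv ?_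
    rw [← smul_neg, neg_sub]
  · exact (Y.continuousOn_yt.fun_sub (Y.continuousOn_yt.comp hshift hm)).fun_const_smul h⁻¹
  · exact ((Y.continuousOn_yxx.comp hshift hm).fun_sub Y.continuousOn_yxx).fun_const_smul h⁻¹

/-! ### The boundary trace -/

lemma memLp_volT_of_continuousOn {b : ℝ → ℝ} {T : ℝ} (hb : ContinuousOn b (Icc 0 T)) :
    MemLp b 2 (volT T) := by
  obtain ⟨C, hC⟩ := isCompact_Icc.exists_bound_of_continuousOn hb
  have : IsFiniteMeasure (volT T) := by unfold volT; infer_instance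
  refine MemLp.of_bound ((hb.mono Ioo_subset_Icc_self).aestronglyMeasurable measurableSet_Ioo) C ?_
  filter_upwards [ae_restrict_mem measurableSet_Ioo] with x hx using hC x ⟨hx.1.le, hx.2.le⟩

lemma norm_toLp_sq {T : ℝ} {g : ℝ → ℝ} (hg : MemLp g 2 (volT T)) :
    ‖hg.toLp g‖ ^ 2 = ∫ t in Ioo 0 T, g t ^ 2 := by
  rw [← real_inner_self_eq_norm_sq, L2.inner_def]
  refine integral_congr_ae ?_
  filter_upwards [hg.coeFn_toLp] with x hx
  rw [hx, sq]; rfl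

lemma integral_Ioo_eq {T : ℝ} (hT : 0 ≤ T) (g : ℝ → ℝ) :
    ∫ t in Ioo 0 T, g t = ∫ t in (0 : ℝ)..T, g t := by
  rw [intervalIntegral.integral_of_le hT, integral_Ioc_eq_integral_Ioo]

lemma MildSolution.energy_eq (hw : IsWeight a K) (Y : MildSolution a) (t : ℝ) :
    Y.energy t = (‖Y.yt t‖ ^ 2 + ‖Y.yxx t‖ ^ 2) / 2 := by
  have i1 := hw.intervalIntegrable_mul (Y.yt t) (Y.yt t)
  have i2 := intervalIntegrable_mul_L2 (Y.yxx t) (Y.yxx t)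
  rw [MildSolution.energy, integral_Ioo_eq zero_le_one, ← real_inner_self_eq_norm_sq,
    ← real_inner_self_eq_norm_sq, hw.inner_eq, inner_L2_eq, ← intervalIntegral.integral_add i1 i2]
  simp only [sq]
  ring

lemma tendsto_of_norm_sq_add {ι E F : Type*} [NormedAddCommGroup E] [NormedAddCommGroup F]
    {l : Filter ι} {u : ι → E} {v : ι → F} {u₀ : E} {v₀ : F}
    (h : Tendsto (fun n => ‖u n - u₀‖ ^ 2 + ‖v n - v₀‖ ^ 2) l (𝓝 0)) :
    Tendsto u l (𝓝 u₀) ∧ Tendsto v l (𝓝 v₀) := by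
  have hs : Tendsto (fun n => √(‖u n - u₀‖ ^ 2 + ‖v n - v₀‖ ^ 2)) l (𝓝 0) := by
    simpa using h.sqrt
  constructor
  · rw [tendsto_iff_norm_sub_tendsto_zero]
    refine squeeze_zero (fun _ => norm_nonneg _) (fun n => Real.le_sqrt_of_sq_le ?_) hs
    have := sq_nonneg ‖v n - v₀‖; linarith
  · rw [tendsto_iff_norm_sub_tendsto_zero]
    refine squeeze_zero (fun _ => norm_nonneg _) (fun n => Real.le_sqrt_of_sq_le ?_) hs
    have := sq_nonneg ‖u n - u₀‖; linarith

/-- Every mild solution has a boundary trace. -/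
lemma MildSolution.exists_hasBoundaryTrace (hw : IsWeight a K) (Y : MildSolution a) {T : ℝ}
    (hT : 0 ≤ T) : ∃ g, Y.HasBoundaryTrace T g := by
  set h : ℕ → ℝ := fun n => 1 / ((n : ℝ) + 1) with hh
  have hpos : ∀ n, 0 < h n := fun n => Nat.one_div_pos_of_nat
  have hlim : Tendsto h atTop (𝓝[>] 0) := tendsto_nhdsWithin_iff.2
    ⟨tendsto_one_div_add_atTop_nhds_zero_nat, Eventually.of_forall hpos⟩
  have hd := fun n => Y.isClassicalData_avg hw (hpos n).le
  set Z : ℕ → MildSolution a := fun n => (hd n).toMild hw with hZ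
  have hq : Tendsto (fun n => (Z n).yxx 0) atTop (𝓝 (Y.yxx 0)) :=
    (tendsto_avg_zero Y.continuousOn_yxx).comp hlim
  have hv : Tendsto (fun n => (Z n).yt 0) atTop (𝓝 (Y.yt 0)) := by
    have h1 : HasDerivWithinAt Y.y (Y.yt 0) (Ioi 0) 0 :=
      (Y.hasDeriv_y 0 le_rfl).mono Ioi_subset_Ici_self
    have h2 := (hasDerivWithinAt_iff_tendsto_slope' (by simp)).1 h1
    refine (h2.comp hlim).congr fun n => ?_
    simp [hZ, IsClassicalData.toMild, slope_def_module]
  have htr : ∀ n t, 0 ≤ t → ∃ b, HasBdryValue ((Z n).yxx t) 1 b := fun n t ht => by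
    obtain ⟨b, hb, -⟩ := hw.inDA_trace ((hd n).inH2 t ht) ((hd n).inDA t ht)
    exact ⟨b, hb⟩
  choose! β hβ using htr
  have hβ' : ∀ n, ∀ t ∈ Icc 0 T, HasBdryValue ((Z n).yxx t) 1 (β n t) := fun n t ht => hβ n t ht.1
  have hmem : ∀ n, MemLp (β n) 2 (volT T) := fun n =>
    memLp_volT_of_continuousOn ((hd n).continuousOn_trace hw (hβ' n))
  set D := 2 / √(a 1) + 3 * T with hD
  -- The direct inequality, applied to the difference of two averaged solutions, bounds the distance
  -- of their traces by that of their initial data.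
  have hle : ∀ n k, dist ((hmem n).toLp (β n)) ((hmem k).toLp (β k)) ≤
      √(D * (‖(Z n).yt 0 - (Z k).yt 0‖ ^ 2 + ‖(Z n).yxx 0 - (Z k).yxx 0‖ ^ 2)) := by
    intro n k
    refine Real.le_sqrt_of_sq_le ?_
    have hb : ∀ t ∈ Icc 0 T, HasBdryValue ((avg (h n) Y.yxx - avg (h k) Y.yxx) t) 1
        ((β n - β k) t) := fun t ht =>
      HasBdryValue.congr ((hβ n t ht.1).sub (hβ k t ht.1))
        (Lp.coeFn_sub ((Z n).yxx t) ((Z k).yxx t)).symm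
    have := ((hd n).sub hw (hd k)).integral_trace_sq_le hw hT hb
    rw [dist_eq_norm, ← MemLp.toLp_sub, norm_toLp_sq, integral_Ioo_eq hT]
    exact this
  have hcauchy : CauchySeq fun n => (hmem n).toLp (β n) := by
    rw [cauchySeq_iff_tendsto_dist_atTop_0]
    refine squeeze_zero (fun _ => dist_nonneg) (fun p => hle p.1 p.2) ?_
    have c1 := cauchySeq_iff_tendsto_dist_atTop_0.1 hv.cauchySeq
    have c2 := cauchySeq_iff_tendsto_dist_atTop_0.1 hq.cauchySeq
    simp only [dist_eq_norm] at c1 c2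
    simpa using (((c1.pow 2).add (c2.pow 2)).const_mul D).sqrt
  obtain ⟨g, hg⟩ := cauchySeq_tendsto_of_complete hcauchy
  have hgm := Lp.memLp g
  refine ⟨g, hgm, Z, β, fun n => (hd n).isClassical_toMild hw, hβ', hmem, ?_, ?_⟩
  · have c1 := tendsto_iff_norm_sub_tendsto_zero.1 hq
    have c2 := tendsto_iff_norm_sub_tendsto_zero.1 hv
    simpa using (c1.pow 2).add (c2.pow 2)
  · rw [← Lp.tendsto_Lp_iff_tendsto_eLpNorm'' β hmem g hgm, Lp.toLp_coeFn]
    exact hg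

/-- The observability inequality for mild solutions. -/
lemma MildSolution.HasBoundaryTrace.le_integral (hw : IsWeight a K) {Y : MildSolution a} {T : ℝ}
    (hT : 0 ≤ T) {g : ℝ → ℝ} (hg : Y.HasBoundaryTrace T g) {m : ℝ} (hm1 : 1 ≤ m)
    (hm2 : 4 / a 1 ≤ m) :
    (T * (2 - K) - 4 * m) * Y.energy 0 ≤ ∫ t in Ioo 0 T, g t ^ 2 := by
  obtain ⟨hgm, Z, β, hZ, hβ, hmem, h0, hlim⟩ := hg
  obtain ⟨hq, hv⟩ := tendsto_of_norm_sq_add h0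
  rw [← Lp.tendsto_Lp_iff_tendsto_eLpNorm'' β hmem g hgm] at hlim
  rw [Y.energy_eq hw, ← norm_toLp_sq hgm]
  -- Both sides are continuous along the approximating sequence supplied by the trace g itself, so
  -- uniqueness of the trace is not needed.
  refine le_of_tendsto_of_tendsto'
    ((((hv.norm.pow 2).add (hq.norm.pow 2)).div_const 2).const_mul _) (hlim.norm.pow 2)
    fun n => ?_
  obtain ⟨f, r, hd⟩ := (hZ n).exists_data
  rw [norm_toLp_sq, integral_Ioo_eq hT]
  exact hd.le_integral_trace_sq hw hT (hβ n) hm1 hm2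

end

end Beam

theorem corollary3p12 (a : ℝ → ℝ)
    (ha : Beam.WeaklyDegenerate a ∨ Beam.StronglyDegenerate a) (T : ℝ)
    (hT : 4 / (2 - Beam.degConst a) *
      max 1 (max (4 / a 1) (4 * Beam.degConst a / a 1)) < T) :
    Beam.Observable a T ∧
      ((T * (2 - Beam.degConst a) -
        4 * max 1 (max (4 / a 1) (4 * Beam.degConst a / a 1)) : ℝ) : EReal) ≤
        Beam.bestConst a T := by
  have hw := Beam.isWeight_degConst ha
  set K := Beam.degConst a
  set m := max 1 (max (4 / a 1) (4 * K / a 1))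
  have hm1 : 1 ≤ m := le_max_left _ _
  have hm2 : 4 / a 1 ≤ m := (le_max_left _ _).trans (le_max_right _ _)
  have hK : 0 < 2 - K := sub_pos.2 hw.K_lt
  have hT0 : 0 ≤ T := le_trans (by positivity) hT.le
  have hpos : 0 < T * (2 - K) - 4 * m := by
    rw [div_mul_eq_mul_div, div_lt_iff₀ hK] at hT
    linarith
  -- The claimed lower bound is itself an admissible constant: the condition on T says exactly that
  -- it is positive. Hence it lies below the supremum.
  have hobs : Beam.IsObservabilityConstant a T (T * (2 - K) - 4 * m) :=
    ⟨hpos, fun Y => ⟨Y.exists_hasBoundaryTrace hw hT0, fun g hg =>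
      hg.le_integral hw hT0 hm1 hm2⟩⟩
  exact ⟨⟨_, hobs⟩, le_sSup ⟨_, hobs, rfl⟩⟩
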